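/- **Setting.** Let $\mathcal A$ be a finite or countable set with $|\mathcal A|>1$, let $\Omega=\mathcal A^{\mathbb N}$ with the $\sigma$-algebra $\mathcal F$ generated by the coordinates, let $T$ be the left shift on $\Omega$, and let $\mathbb P$ be a $T$-invariant probability measure on $(\Omega,\mathcal F)$ that is not a point mass (equivalently, $\mathbb P\{\omega_0=a\}<1$ for every $a\in\mathcal A$). Assume that $\mathbb P$ is $\psi$-mixing: there are reals $\psi_m\ge 0$ with $\psi_m\to 0$ such that $$|\mathbb P(E\cap T^{-(n+m)}F)-\mathbb P(E)\mathbb P(F)|\le \psi_m\,\mathbb P(E)\,\mathbb P(F)$$ for all $m,n\in\mathbb N$, all $E$ in the $\sigma$-algebra generated by the coordinates $0,\dots,n-1$, and all $F\in\mathcal F$. Fix $t>0$ and integers $1\le d_1<\dots<d_\ell$ with $\ell\ge 1$. For $\omega\in\Omega$ and $n\ge 1$ let $A_n^\omega=\{\gamma\in\Omega:\gamma_i=\omega_i \text{ for } 0\le i<n\}$; such a set is called an $n$-cylinder. For a cylinder $A$ and $N\in\mathbb N$ put $$S_N^A=\sum_{k=1}^{N}\prod_{j=1}^{\ell}1_A\circ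 T^{d_jk}.$$ If $\mathbb P(A_n^\omega)>0$, put $N_n=\lfloor t\,\mathbb P(A_n^\omega)^{-\ell}\rfloor$. For $r\ge 1$ put $\kappa(r)=\operatorname{lcm}\{r/\gcd(r,d_j):1\le j\le \ell\}$. For an $n$-cylinder $A=\{\gamma:\gamma_i=a_i,\ 0\le i<n\}$ with $\mathbb P(A)>0$ let $\pi(A)=\min\{j\in\{1,\dots,n\}:A\cap T^{-j}A\ne\emptyset\}$ and $$\rho_A=\prod_{j=1}^{\ell}\mathbb P\big(R_{n+d_j\kappa(\pi(A))}\,\big|\,A\big),\qquad R_m=\{\gamma:\gamma_i=a_{i \bmod \pi(A)},\ 0\le i<m\}.$$ For $0<s$ and $p\in[0,1)$ the Pólya–Aeppli law $PA(s,p)$ is the probability measure on $\mathbb N$ with $PA(s,p)\{0\}=e^{-s}$ and $$PA(s,p)\{k\}=e^{-s}\sum_{j=1}^{k}\binom{k-1}{j-1}\frac{s^j}{j!}\,p^{k-j}(1-p)^j\qquad(k\ge 1).$$ **Theorem.** Let $\omega\in\Omega$ satisfy $\mathbb P(A_n^\omega)>0$ for all $n\ge1$, and suppose that $\omega$ is periodic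 under $T$ with minimal period $r\ge 1$. For $n\geq 1$ put $\beta_{\omega,n}=\mathbb P(A_{n+r}^\omega\mid A_n^\omega)$. (a) If $\lim_{n\to\infty}\rho_{A_n^\omega}$ does not exist, then the sequence $S_{N_n}^{A_n^\omega}$ (under $\mathbb P$) does not converge in distribution. (b) If the limit $\beta_\omega=\lim_{n\to\infty}\beta_{\omega,n}$ exists, then the limit $\rho_\omega=\lim_{n\to\infty}\rho_{A_n^\omega}$ exists, $\rho_\omega=\beta_\omega^{a}$ with $a=\frac{\kappa(r)}{r}\sum_{i=1}^{\ell}d_i\in\mathbb N$, one has $0\le \rho_\omega<1$, and the law of $S_{N_n}^{A_n^\omega}$ under $\mathbb P$ converges in distribution to $PA(t(1-\rho_\omega),\rho_\omega)$ as $n\to\infty$. -/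

import Mathlib

open MeasureTheory Filter Topology
open scoped BigOperators

noncomputable section

namespace ShiftReturns

variable {𝒜 : Type*}

/-- The left shift on `𝒜^ℕ`. -/
def shift (x : ℕ → 𝒜) : ℕ → 𝒜 := fun n => x (n + 1)

/-- The cylinder `[x 0, …, x (n-1)]`, that is `A_n^x`. -/
def cyl (x : ℕ → 𝒜) (n : ℕ) : Set (ℕ → 𝒜) := {y | ∀ i < n, y i = x i}

/-- The sigma-algebra `F_J` generated by the events `{x | x j = a}` with `j ∈ J`, `a ∈ 𝒜`. -/
@[reducible] def coordSigma (J : Set ℕ) : MeasurableSpace (ℕ → 𝒜) :=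
  MeasurableSpace.generateFrom {E | ∃ j ∈ J, ∃ a : 𝒜, E = {x | x j = a}}

/-- `ψ`-mixing. -/
def PsiMixing [MeasurableSpace 𝒜] (P : Measure (ℕ → 𝒜)) : Prop :=
  ∃ ψ : ℕ → ℝ, (∀ m, 0 ≤ ψ m) ∧ Tendsto ψ atTop (𝓝 0) ∧
    ∀ (m n : ℕ) (E F : Set (ℕ → 𝒜)),
      MeasurableSet[coordSigma (Set.Iio n)] E → MeasurableSet F →
        |P.real (E ∩ (shift^[n + m]) ⁻¹' F) - P.real E * P.real F| ≤ ψ m * P.real E * P.real F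

/-- The period `π(A)` of the `n`-cylinder `A = [x 0, …, x (n-1)]`, `n ≥ 1`: the least
`j ∈ {1, …, n}` with `A ∩ T^{-j} A ≠ ∅` (the choice `j = n` always qualifies). -/
def cylPeriod (x : ℕ → 𝒜) (n : ℕ) : ℕ :=
  sInf {j | 1 ≤ j ∧ j ≤ n ∧ (cyl x n ∩ (shift^[j]) ⁻¹' cyl x n).Nonempty}

/-- The cylinder `R^{m/r}` of length `m`, where `R = [x 0, …, x (r-1)]`: its word is the prefix of
length `m` of the `r`-periodic sequence that repeats `x 0, …, x (r-1)`. -/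
def repeatCyl (x : ℕ → 𝒜) (r m : ℕ) : Set (ℕ → 𝒜) := cyl (fun i => x (i % r)) m

/-- `κ(r) = lcm {r / gcd (r, d_j) : 1 ≤ j ≤ ℓ}`. -/
def kappa {ℓ : ℕ} (d : Fin ℓ → ℕ) (r : ℕ) : ℕ :=
  Finset.univ.lcm fun j => r / Nat.gcd r (d j)

/-- The exponent `a = (κ(r) / r) ∑ d_i`, a natural number; see `mul_returnExponent`. -/
def returnExponent {ℓ : ℕ} (d : Fin ℓ → ℕ) (r : ℕ) : ℕ :=
  (kappa d r * ∑ i, d i) / r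

/-- The division in `returnExponent` is exact. -/
theorem mul_returnExponent {ℓ : ℕ} (d : Fin ℓ → ℕ) (r : ℕ) :
    r * returnExponent d r = kappa d r * ∑ i, d i := by
  refine Nat.mul_div_cancel' ?_
  rw [Finset.mul_sum]
  refine Finset.dvd_sum fun i _ => ?_
  have h1 : r / Nat.gcd r (d i) ∣ kappa d r :=
    Finset.dvd_lcm (f := fun j => r / Nat.gcd r (d j)) (Finset.mem_univ i)
  calc r = r / Nat.gcd r (d i) * Nat.gcd r (d i) :=
        (Nat.div_mul_cancel (Nat.gcd_dvd_left _ _)).symm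
    _ ∣ kappa d r * d i := mul_dvd_mul h1 (Nat.gcd_dvd_right _ _)

/-- `ρ_A = ∏_j P(R^{(n + d_j κ(r))/r} | A)` for the `n`-cylinder `A = [x 0, …, x (n-1)]`, with
`r = π(A)` and `R = [x 0, …, x (r-1)]`. -/
def rho [MeasurableSpace 𝒜] (P : Measure (ℕ → 𝒜)) {ℓ : ℕ} (d : Fin ℓ → ℕ)
    (x : ℕ → 𝒜) (n : ℕ) : ℝ :=
  ∏ j, (ProbabilityTheory.cond P (cyl x n)).real
    (repeatCyl x (cylPeriod x n) (n + d j * kappa d (cylPeriod x n)))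

/-- `β_{x,n} = P(A_{n+r}^x | A_n^x)`. -/
def beta [MeasurableSpace 𝒜] (P : Measure (ℕ → 𝒜)) (r : ℕ) (x : ℕ → 𝒜) (n : ℕ) : ℝ :=
  (ProbabilityTheory.cond P (cyl x n)).real (cyl x (n + r))

/-- The multiple-return count `S_N^A = ∑_{k=1}^N ∏_j 1_A ∘ T^{d_j k}`. -/
def returnCount {ℓ : ℕ} (d : Fin ℓ → ℕ) (A : Set (ℕ → 𝒜)) (N : ℕ) (x : ℕ → 𝒜) : ℕ :=
  ∑ k ∈ Finset.Icc 1 N, ∏ j, A.indicator (fun _ => 1) (shift^[d j * k] x)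

/-- The number of trials `N_n = ⌊t P(A_n^x)^{-ℓ}⌋`. -/
def trials [MeasurableSpace 𝒜] (P : Measure (ℕ → 𝒜)) (ℓ : ℕ) (t : ℝ) (x : ℕ → 𝒜) (n : ℕ) : ℕ :=
  ⌊t * ((P.real (cyl x n)) ^ ℓ)⁻¹⌋₊

theorem measurable_shift [MeasurableSpace 𝒜] : Measurable (shift (𝒜 := 𝒜)) :=
  measurable_pi_lambda _ fun n => measurable_pi_apply (n + 1)

theorem measurableSet_cyl [MeasurableSpace 𝒜] [DiscreteMeasurableSpace 𝒜] (x : ℕ → 𝒜) (n : ℕ) :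
    MeasurableSet (cyl x n) := by
  have : cyl x n = ⋂ i ∈ Set.Iio n, (fun y : ℕ → 𝒜 => y i) ⁻¹' {x i} := by
    ext y; simp [cyl]
  rw [this]
  exact MeasurableSet.biInter (Set.to_countable _) fun i _ =>
    measurable_pi_apply i (MeasurableSet.of_discrete)

theorem measurable_returnCount [MeasurableSpace 𝒜] {ℓ : ℕ} (d : Fin ℓ → ℕ) {A : Set (ℕ → 𝒜)}
    (hA : MeasurableSet A) (N : ℕ) : Measurable (returnCount d A N) := by
  unfold returnCount
  refine Finset.measurable_sum _ fun k _ => Finset.measurable_prod _ fun j _ => ?_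
  exact (measurable_const.indicator hA).comp (measurable_shift.iterate _)

/-- The law, on `ℕ`, of the count `S_{N_n}^{A_n^x}` under `P`. -/
def countLaw [MeasurableSpace 𝒜] [DiscreteMeasurableSpace 𝒜] (P : Measure (ℕ → 𝒜))
    [IsProbabilityMeasure P] {ℓ : ℕ} (d : Fin ℓ → ℕ) (t : ℝ) (x : ℕ → 𝒜) (n : ℕ) :
    ProbabilityMeasure ℕ :=
  ⟨P.map (returnCount d (cyl x n) (trials P ℓ t x n)),
    Measure.isProbabilityMeasure_map
      (measurable_returnCount d (measurableSet_cyl x n) _).aemeasurable⟩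

/-- The point masses of the Pólya–Aeppli distribution `PA(s, p)`. -/
def polyaAeppliMass (s p : ℝ) (k : ℕ) : ℝ :=
  if k = 0 then Real.exp (-s)
  else Real.exp (-s) * ∑ j ∈ Finset.Icc 1 k,
    ((k - 1).choose (j - 1) : ℝ) * (s ^ j / (j.factorial : ℝ)) * p ^ (k - j) * (1 - p) ^ j

/-- The Pólya–Aeppli distribution `PA(s, p)` on `ℕ`, for `0 < s` and `0 ≤ p < 1`. -/
def polyaAeppli (s p : ℝ) : Measure ℕ :=
  Measure.sum fun k => ENNReal.ofReal (polyaAeppliMass s p k) • Measure.dirac k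

end ShiftReturns

end

open ShiftReturns

/-! Write `A = cyl ω n`, `p = P(A)`, and let `u k` be the generating function at `z ∈ [0, 1]` of the
number of multiple returns to `A` at times before `k` (from `4 * n` on). Adding time `k` gives the
exact identity `u (k+1) = u k - (1 - z) * ∫ z ^ (past count)`, the integral being over the event
that `k` is a multiple return. Everything rests on evaluating that integral.

Given a return at `k`, periodicity makes the recent past rigid. For returns at `k` and `k - δ` with
small `δ`, the overlapping words force `r ∣ d_j * δ` for all `j`, hence `κ ∣ δ`, and then all
letters between them are prescribed too. So the recent returns form one run with spacing `κ`, and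
`z` to their number is a telescoping sum, with coefficients `gapCoeff`, of indicators of the nested
events `runEvent` (`pow_hitCount_near`). The distant past is nearly independent of a run by
ψ-mixing, each run having probability close to a product of cylinder measures (`BlockMixing`).
Returns in between are too unlikely to matter, thanks to the exponential decay of long words
(`exists_decay`). Thus the integral is `W * u k` up to an error that is small relative to `p ^ ℓ`,
where `W` is `clumpWeight` (`abs_setIntegral_multiReturn_sub_le`).

Iterating `u (k+1) ≈ (1 - (1 - z) * W) * u k` about `t / p ^ ℓ` times gives `exp (-t * (1 - z) * W /
p ^ ℓ)` (`abs_integral_pow_returnCount_sub_le`), whether or not any limit exists. At `z = 0` this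
says that the probability of no return is asymptotically `exp (-t * (1 - ρ_A))`, so convergence in
distribution forces `ρ_A` to converge: this is (a). If `β` exists, the normalised run probabilities
tend to `ρ ^ a`, dominated convergence gives `W / p ^ ℓ → (1 - ρ) / (1 - ρ z)`, and the limit is the
generating function of the Pólya–Aeppli law. Convergence of generating functions gives convergence
of point masses and hence weak convergence: this is (b). -/

namespace ShiftReturns

/-! ### Events determined by blocks of coordinates. -/

section

variable {𝒜 : Type*}

/-- The event `E` is determined by the coordinates in `J`. -/
def DeterminedBy (J : Set ℕ) (E : Set (ℕ → 𝒜)) : Prop :=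
  ∀ x y : ℕ → 𝒜, (∀ i ∈ J, x i = y i) → x ∈ E → y ∈ E

theorem DeterminedBy.iff {J : Set ℕ} {E : Set (ℕ → 𝒜)} (h : DeterminedBy J E) {x y : ℕ → 𝒜}
    (hxy : ∀ i ∈ J, x i = y i) : x ∈ E ↔ y ∈ E :=
  ⟨h x y hxy, h y x fun i hi => (hxy i hi).symm⟩

theorem DeterminedBy.mono {J K : Set ℕ} {E : Set (ℕ → 𝒜)} (h : DeterminedBy J E) (hJK : J ⊆ K) :
    DeterminedBy K E :=
  fun x y hxy => h x y fun i hi => hxy i (hJK hi)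

theorem DeterminedBy.inter {J : Set ℕ} {E F : Set (ℕ → 𝒜)} (hE : DeterminedBy J E)
    (hF : DeterminedBy J F) : DeterminedBy J (E ∩ F) :=
  fun x y hxy hx => ⟨hE x y hxy hx.1, hF x y hxy hx.2⟩

theorem determinedBy_univ (J : Set ℕ) : DeterminedBy J (Set.univ : Set (ℕ → 𝒜)) :=
  fun _ _ _ _ => trivial

theorem DeterminedBy.iInter {ι : Sort*} {J : Set ℕ} {E : ι → Set (ℕ → 𝒜)}
    (h : ∀ i, DeterminedBy J (E i)) : DeterminedBy J (⋂ i, E i) :=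
  fun x y hxy hx => Set.mem_iInter.2 fun i => h i x y hxy (Set.mem_iInter.1 hx i)

theorem shift_iterate_apply (a : ℕ) (x : ℕ → 𝒜) (i : ℕ) : (shift^[a] x) i = x (a + i) := by
  induction a generalizing x with
  | zero => simp
  | succ a ih => rw [Function.iterate_succ_apply, ih]; simp only [shift]; congr 1; omega

theorem DeterminedBy.preimage_shift {L : ℕ} {B : Set (ℕ → 𝒜)} (h : DeterminedBy (Set.Iio L) B)
    (a : ℕ) : DeterminedBy (Set.Ico a (a + L)) (shift^[a] ⁻¹' B) := by
  intro x y hxy hx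
  refine h _ _ (fun i hi => ?_) hx
  rw [shift_iterate_apply, shift_iterate_apply]
  exact hxy _ ⟨by omega, by simpa using hi⟩

theorem determinedBy_cyl (x : ℕ → 𝒜) (n : ℕ) : DeterminedBy (Set.Iio n) (cyl x n) :=
  fun _ _ hyz hy i hi => (hyz i hi).symm.trans (hy i hi)

theorem cyl_anti (x : ℕ → 𝒜) {m n : ℕ} (h : m ≤ n) : cyl x n ⊆ cyl x m :=
  fun _ hy i hi => hy i (hi.trans_le h)

/-- The first `n` coordinates. -/
def word (n : ℕ) (x : ℕ → 𝒜) : Fin n → 𝒜 := fun i => x i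

section measurability

theorem measurable_word [MeasurableSpace 𝒜] (n : ℕ) : Measurable (word (𝒜 := 𝒜) n) :=
  measurable_pi_lambda _ fun _ => measurable_pi_apply _

theorem coordSigma_le [MeasurableSpace 𝒜] [DiscreteMeasurableSpace 𝒜] (J : Set ℕ) :
    coordSigma (𝒜 := 𝒜) J ≤ MeasurableSpace.pi := by
  refine MeasurableSpace.generateFrom_le ?_
  rintro E ⟨j, -, a, rfl⟩
  exact (measurable_pi_apply (X := fun _ => 𝒜) j) (MeasurableSet.of_discrete (s := {a}))

variable [Countable 𝒜]

theorem DeterminedBy.measurableSet_coordSigma {n : ℕ} {E : Set (ℕ → 𝒜)}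
    (h : DeterminedBy (Set.Iio n) E) : MeasurableSet[coordSigma (Set.Iio n)] E := by
  have hE : E = ⋃ w ∈ word n '' E, ⋂ i : Fin n, {x | x i = w i} := by
    ext x
    simp only [Set.mem_iUnion, Set.mem_iInter, Set.mem_ofPred_eq, exists_prop, Set.mem_image]
    constructor
    · intro hx
      exact ⟨word n x, ⟨x, hx, rfl⟩, fun i => rfl⟩
    · rintro ⟨w, ⟨y, hy, rfl⟩, hx⟩
      exact h y x (fun i hi => (hx ⟨i, hi⟩).symm) hy
  rw [hE]
  refine MeasurableSet.biUnion (Set.to_countable _) fun w _ => MeasurableSet.iInter fun i => ?_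
  exact MeasurableSpace.measurableSet_generateFrom ⟨i, i.2, w i, rfl⟩

theorem DeterminedBy.measurableSet [MeasurableSpace 𝒜] [DiscreteMeasurableSpace 𝒜] {n : ℕ} {E : Set (ℕ → 𝒜)}
    (h : DeterminedBy (Set.Iio n) E) : MeasurableSet E :=
  coordSigma_le _ _ h.measurableSet_coordSigma

/-- Countability of the alphabet makes the initial words a countable partition, so estimates can be
proved one word at a time and summed. -/
theorem hasSum_real_word [MeasurableSpace 𝒜] [DiscreteMeasurableSpace 𝒜] (P : Measure (ℕ → 𝒜)) [IsProbabilityMeasure P]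
    (n : ℕ) {G : Set (ℕ → 𝒜)} (hG : MeasurableSet G) :
    HasSum (fun w : Fin n → 𝒜 => P.real (word n ⁻¹' {w} ∩ G)) (P.real G) := by
  have h1 : P G = ∑' w : Fin n → 𝒜, P (word n ⁻¹' {w} ∩ G) := by
    rw [← measure_iUnion]
    · congr 1
      ext x
      simp
    · intro w w' hww'
      rw [Function.onFun, Set.disjoint_left]
      rintro x ⟨hx, -⟩ ⟨hx', -⟩
      exact hww' (hx.symm.trans hx')
    · exact fun w => (measurable_word n (measurableSet_singleton w)).inter hG
  have h2 : (∑' w : Fin n → 𝒜, P (word n ⁻¹' {w} ∩ G)) ≠ ⊤ := h1 ▸ measure_ne_top P G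
  have h3 := ENNReal.hasSum_toReal h2
  rw [← ENNReal.tsum_toReal_eq fun w => measure_ne_top P _, ← h1] at h3
  exact h3

end measurability

/-! ### Mixing for one block against both its past and its future. -/

/-- `e` bounds the `ψ`-mixing coefficients at all gaps of length at least `m`. -/
def MixingAt [MeasurableSpace 𝒜] (P : Measure (ℕ → 𝒜)) (m : ℕ) (e : ℝ) : Prop :=
  ∀ m' ≥ m, ∀ (n : ℕ) (E F : Set (ℕ → 𝒜)), DeterminedBy (Set.Iio n) E → MeasurableSet F →
    |P.real (E ∩ (shift^[n + m']) ⁻¹' F) - P.real E * P.real F| ≤ e * P.real E * P.real F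

/-- Pure arithmetic for a past word `C`, a block `B` and a future `F`: `X`, `G`, `Y` stand for the
measures of `C ∩ B ∩ F`, `C ∩ B`, `C ∩ F`. The constant 7 comes from `(1 + e)² (1 + 2e) ≤ 1 + 7e`,
an equality at `e = 1/2`. -/
theorem abs_sub_le_of_three_mixing {e X G C F B Y : ℝ} (he0 : 0 ≤ e) (he : e ≤ 1 / 2)
    (hC : 0 ≤ C) (hF : 0 ≤ F) (hB : 0 ≤ B)
    (h1 : |X - G * F| ≤ e * G * F) (h2 : |G - C * B| ≤ e * C * B)
    (h3 : |Y - C * F| ≤ e * C * F) : |X - B * Y| ≤ 7 * e * B * Y := by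
  rw [abs_le] at *
  have hCF : 0 ≤ C * F := by positivity
  have hu : C * F ≤ (1 + 2 * e) * Y := by nlinarith
  have hl : Y ≤ (1 + e) * (C * F) := by linarith
  have hY0 : 0 ≤ Y := by nlinarith
  have hX1 : X ≤ (1 + e) * ((1 + e) * (C * B)) * F := by
    have : (1 + e) * G * F ≤ (1 + e) * ((1 + e) * (C * B)) * F := by gcongr; linarith
    linarith
  have hX2 : (1 - e) * ((1 - e) * (C * B)) * F ≤ X := by
    have : 0 ≤ 1 - e := by linarith
    have : (1 - e) * ((1 - e) * (C * B)) * F ≤ (1 - e) * G * F := by gcongr; linarith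
    linarith
  have hBY : 0 ≤ B * Y := by positivity
  have hBu : B * (C * F) ≤ B * ((1 + 2 * e) * Y) := by gcongr
  have hBl : B * Y ≤ B * ((1 + e) * (C * F)) := by gcongr
  have hB0 : 0 ≤ B * (C * F) := by positivity
  have hee : 0 ≤ e * (B * (C * F)) := by positivity
  have hee2 : 0 ≤ e * (e * (B * (C * F))) := by positivity
  have heY : 0 ≤ e * (B * Y) := by positivity
  constructor
  · by_cases h : 0 ≤ 1 - 3 * e
    · have := mul_le_mul_of_nonneg_left hBl h
      nlinarith
    · have hX0 : 0 ≤ X := by nlinarith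
      nlinarith
  · have h7 := mul_le_mul_of_nonneg_left hBu (by positivity : 0 ≤ (1 + e) * (1 + e))
    have h8 : (1 + e) * (1 + e) * (1 + 2 * e) ≤ 1 + 7 * e := by
      nlinarith [mul_nonneg he0 he0, mul_nonneg he0 (sub_nonneg.2 he),
        mul_nonneg (mul_nonneg he0 he0) (sub_nonneg.2 he)]
    nlinarith [mul_le_mul_of_nonneg_right h8 hBY]

section mixing

variable [MeasurableSpace 𝒜] [Countable 𝒜] {P : Measure (ℕ → 𝒜)}

theorem PsiMixing.eventually_mixingAt (h : PsiMixing P) {e : ℝ} (he : 0 < e) :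
    ∀ᶠ m in atTop, MixingAt P m e := by
  obtain ⟨ψ, -, hlim, hψ⟩ := h
  obtain ⟨M, hM⟩ := eventually_atTop.1 (hlim.eventually (gt_mem_nhds he))
  filter_upwards [eventually_ge_atTop M] with m hm m' hm' n E F hE hF
  refine (hψ m' n E F hE.measurableSet_coordSigma hF).trans ?_
  have := (hM m' (hm.trans hm')).le
  gcongr

variable [DiscreteMeasurableSpace 𝒜] [IsProbabilityMeasure P]

/-- An event off the block `[b + m, b + m + L)` and its `m`-neighbourhood is almost independent
of an event carried by the block. -/
theorem MixingAt.abs_inter_sub_le {m : ℕ} {e : ℝ} (h : MixingAt P m e) (he0 : 0 ≤ e)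
    (he : e ≤ 1 / 2) {b L : ℕ} {B E : Set (ℕ → 𝒜)} (hB : DeterminedBy (Set.Iio L) B)
    (hE : DeterminedBy (Set.Iio b ∪ Set.Ici (b + m + L + m)) E) (hEm : MeasurableSet E) :
    |P.real (E ∩ shift^[b + m] ⁻¹' B) - P.real E * P.real B| ≤
      7 * e * P.real B * P.real E := by
  have hBm : MeasurableSet (shift^[b + m] ⁻¹' B) := measurable_shift.iterate _ hB.measurableSet
  have hX := hasSum_real_word P b (hEm.inter hBm)
  have hY := hasSum_real_word P b hEm
  have key : ∀ w : Fin b → 𝒜, |P.real (word b ⁻¹' {w} ∩ (E ∩ shift^[b + m] ⁻¹' B)) -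
      P.real B * P.real (word b ⁻¹' {w} ∩ E)| ≤
        7 * e * P.real B * P.real (word b ⁻¹' {w} ∩ E) := by
    intro w
    set C : Set (ℕ → 𝒜) := word b ⁻¹' {w} with hC
    -- Once the first `b` letters are frozen to `w`, the event `E` depends only on the coordinates
    -- after the block. Prefixing `w` turns it into a pure future event, to which ψ-mixing applies.
    let glue : (ℕ → 𝒜) → (ℕ → 𝒜) := fun y i =>
      if hi : i < b then w ⟨i, hi⟩ else y (i - (b + m + L + m))
    have hglue : Measurable glue := by
      refine measurable_pi_lambda _ fun i => ?_
      by_cases hi : i < b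
      · simp [glue, hi]
      · simpa [glue, hi] using measurable_pi_apply _
    have hCdet : DeterminedBy (Set.Iio b) C := by
      intro x y hxy hx
      have : word b x = w := hx
      rw [hC, Set.mem_preimage, Set.mem_singleton_iff, ← this]
      exact funext fun i => (hxy i i.2).symm
    have hCE : C ∩ E = C ∩ shift^[b + (m + L + m)] ⁻¹' (glue ⁻¹' E) := by
      ext x
      simp only [Set.mem_inter_iff, Set.mem_preimage]
      refine and_congr_right fun hx => hE.iff fun i hi => ?_
      have hx' : word b x = w := hx
      by_cases hib : i < b
      · simp only [glue, hib, dif_pos, ← hx']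
        rfl
      · have : b + m + L + m ≤ i := by
          rcases hi with hi | hi
          · exact absurd hi hib
          · exact hi
        simp only [glue, hib, dif_neg, not_false_eq_true, shift_iterate_apply]
        congr 1
        omega
    have hFm : MeasurableSet (glue ⁻¹' E) := hglue hEm
    have hG : DeterminedBy (Set.Iio (b + m + L)) (C ∩ shift^[b + m] ⁻¹' B) :=
      (hCdet.mono fun i hi => by simp only [Set.mem_Iio] at *; omega).inter
        ((hB.preimage_shift _).mono fun i hi => hi.2)
    have h1 := h m le_rfl _ _ _ hG hFm
    have h2 := h m le_rfl _ _ _ hCdet hB.measurableSet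
    have h3 := h (m + L + m) (by omega) _ _ _ hCdet hFm
    rw [← hCE] at h3
    have hset : C ∩ shift^[b + m] ⁻¹' B ∩ shift^[b + m + L + m] ⁻¹' (glue ⁻¹' E) =
        C ∩ (E ∩ shift^[b + m] ⁻¹' B) := by
      rw [← Set.inter_assoc, hCE, show b + m + L + m = b + (m + L + m) by ring]
      ext x
      simp only [Set.mem_inter_iff]
      tauto
    rw [hset] at h1
    exact abs_sub_le_of_three_mixing he0 he measureReal_nonneg measureReal_nonneg
      measureReal_nonneg h1 h2 h3
  have hsub := hX.sub (hY.mul_left (P.real B))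
  have hbd := hY.mul_left (7 * e * P.real B)
  rw [mul_comm (P.real E), abs_le]
  constructor
  · rw [← neg_le_neg_iff, neg_neg]
    exact hasSum_le (fun w => by have := (abs_le.1 (key w)).1; linarith) hsub.neg hbd
  · exact hasSum_le (fun w => (abs_le.1 (key w)).2) hsub hbd

end mixing

end

/-! ### Several separated blocks, and decay of long words. -/

section

variable {𝒜 : Type*}

theorem DeterminedBy.iInter_preimage_shift {ι : Type*} {s : Finset ι} {a L : ι → ℕ}
    {B : ι → Set (ℕ → 𝒜)} (hB : ∀ j, DeterminedBy (Set.Iio (L j)) (B j)) {J : Set ℕ}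
    (hJ : ∀ j ∈ s, Set.Ico (a j) (a j + L j) ⊆ J) :
    DeterminedBy J (⋂ j ∈ s, shift^[a j] ⁻¹' B j) :=
  DeterminedBy.iInter fun j => DeterminedBy.iInter fun hj =>
    ((hB j).preimage_shift (a j)).mono (hJ j hj)

section mixing

variable [MeasurableSpace 𝒜] {P : Measure (ℕ → 𝒜)}

/-- Up to the relative error `η`, any `ℓ` blocks at mutual distance at least `m` (and at distance
at least `m` from the origin) are independent of each other and of the rest of the coordinates at
distance at least `m` from them. -/
def BlockMixing (P : Measure (ℕ → 𝒜)) (ℓ m : ℕ) (η : ℝ) : Prop :=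
  ∀ (s : Finset (Fin ℓ)) (a L : Fin ℓ → ℕ) (B : Fin ℓ → Set (ℕ → 𝒜)) (E : Set (ℕ → 𝒜)),
    (∀ j, DeterminedBy (Set.Iio (L j)) (B j)) → (∀ j ∈ s, m ≤ a j) →
    (∀ i ∈ s, ∀ j ∈ s, i ≠ j → a i + L i + m ≤ a j ∨ a j + L j + m ≤ a i) →
    (∀ j ∈ s, DeterminedBy (Set.Iio (a j - m) ∪ Set.Ici (a j + L j + m)) E) →
    MeasurableSet E →
    |P.real (E ∩ ⋂ j ∈ s, shift^[a j] ⁻¹' B j) - (∏ j ∈ s, P.real (B j)) * P.real E| ≤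
      η * ((∏ j ∈ s, P.real (B j)) * P.real E)

theorem BlockMixing.mono {ℓ m : ℕ} {η η' : ℝ} (h : BlockMixing P ℓ m η) (hη : η ≤ η') :
    BlockMixing P ℓ m η' := by
  intro s a L B E h1 h2 h3 h4 h5
  refine (h s a L B E h1 h2 h3 h4 h5).trans ?_
  have : 0 ≤ (∏ j ∈ s, P.real (B j)) * P.real E :=
    mul_nonneg (Finset.prod_nonneg fun _ _ => measureReal_nonneg) measureReal_nonneg
  gcongr

theorem BlockMixing.measureReal_le [IsProbabilityMeasure P] {ℓ m : ℕ} {η : ℝ}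
    (h : BlockMixing P ℓ m η) (hη : η ≤ 1)
    (a L : Fin ℓ → ℕ) (B : Fin ℓ → Set (ℕ → 𝒜)) (hB : ∀ j, DeterminedBy (Set.Iio (L j)) (B j))
    (ha : ∀ j, m ≤ a j)
    (hsep : ∀ i j, i ≠ j → a i + L i + m ≤ a j ∨ a j + L j + m ≤ a i) :
    P.real (⋂ j, shift^[a j] ⁻¹' B j) ≤ 2 * ∏ j, P.real (B j) := by
  have := h Finset.univ a L B Set.univ hB (fun j _ => ha j) (fun i _ j _ => hsep i j)
    (fun j _ => determinedBy_univ _) MeasurableSet.univ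
  simp only [Finset.mem_univ, Set.iInter_true, Set.univ_inter, probReal_univ, mul_one] at this
  have h0 : 0 ≤ ∏ j, P.real (B j) := Finset.prod_nonneg fun _ _ => measureReal_nonneg
  nlinarith [(abs_le.1 this).2]

variable [Countable 𝒜] [DiscreteMeasurableSpace 𝒜]

/-- Blocks are split off one at a time: the remaining blocks together with `E` form an event off the
neighbourhood of the chosen block, so each removal costs a factor `1 ± 7e`. -/
theorem MixingAt.blockMixing [IsProbabilityMeasure P] {m : ℕ} {e : ℝ} (h : MixingAt P m e)
    (he0 : 0 ≤ e) (he : e ≤ 1 / 2) (ℓ : ℕ) : BlockMixing P ℓ m ((1 + 7 * e) ^ ℓ - 1) := by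
  intro s a L B E hB ha hsep hE hEm
  have main : |P.real (E ∩ ⋂ j ∈ s, shift^[a j] ⁻¹' B j) - (∏ j ∈ s, P.real (B j)) * P.real E| ≤
      ((1 + 7 * e) ^ s.card - 1) * ((∏ j ∈ s, P.real (B j)) * P.real E) := by
    induction s using Finset.induction_on with
    | empty => simp
    | insert i s hi ih =>
      have ih := ih (fun j hj => ha j (Finset.mem_insert_of_mem hj))
        (fun j hj k hk => hsep j (Finset.mem_insert_of_mem hj) k (Finset.mem_insert_of_mem hk))
        (fun j hj => hE j (Finset.mem_insert_of_mem hj))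
      have hai := ha i (Finset.mem_insert_self _ _)
      rw [Finset.prod_insert hi, Finset.card_insert_of_notMem hi]
      have hset : E ∩ ⋂ j ∈ insert i s, shift^[a j] ⁻¹' B j =
          (E ∩ ⋂ j ∈ s, shift^[a j] ⁻¹' B j) ∩ shift^[a i - m + m] ⁻¹' B i := by
        rw [Finset.set_biInter_insert, Nat.sub_add_cancel hai]
        ext x
        simp only [Set.mem_inter_iff]
        tauto
      have hmeas : MeasurableSet (E ∩ ⋂ j ∈ s, shift^[a j] ⁻¹' B j) :=
        hEm.inter (Finset.measurableSet_biInter _ fun j _ =>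
          measurable_shift.iterate _ (hB j).measurableSet)
      have hdet : DeterminedBy (Set.Iio (a i - m) ∪ Set.Ici (a i - m + m + L i + m))
          (E ∩ ⋂ j ∈ s, shift^[a j] ⁻¹' B j) := by
        rw [Nat.sub_add_cancel hai]
        refine (hE i (Finset.mem_insert_self _ _)).inter
          (DeterminedBy.iInter_preimage_shift hB fun j hj k hk => ?_)
        have hij : i ≠ j := fun h => hi (h ▸ hj)
        simp only [Set.mem_union, Set.mem_Iio, Set.mem_Ici, Set.mem_Ico] at hk ⊢
        have := hsep i (Finset.mem_insert_self _ _) j (Finset.mem_insert_of_mem hj) hij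
        omega
      have h1 := h.abs_inter_sub_le he0 he (hB i) hdet hmeas
      rw [← hset] at h1
      set X := P.real (E ∩ ⋂ j ∈ insert i s, shift^[a j] ⁻¹' B j)
      set Y := P.real (E ∩ ⋂ j ∈ s, shift^[a j] ⁻¹' B j)
      set Z := (∏ j ∈ s, P.real (B j)) * P.real E
      have hZ : (P.real (B i) * ∏ j ∈ s, P.real (B j)) * P.real E = P.real (B i) * Z := by
        simp only [Z]; ring
      rw [hZ]
      have hb : 0 ≤ P.real (B i) := measureReal_nonneg
      have hY : P.real (B i) * Y ≤ P.real (B i) * ((1 + 7 * e) ^ s.card * Z) := by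
        apply mul_le_mul_of_nonneg_left _ hb
        linarith [(abs_le.1 ih).2]
      have h2 : |P.real (B i) * Y - P.real (B i) * Z| ≤
          P.real (B i) * (((1 + 7 * e) ^ s.card - 1) * Z) := by
        rw [← mul_sub, abs_mul, abs_of_nonneg hb]
        gcongr
      calc |X - P.real (B i) * Z|
          ≤ |X - Y * P.real (B i)| + |P.real (B i) * Y - P.real (B i) * Z| := by
            rw [mul_comm Y]; exact abs_sub_le _ _ _
        _ ≤ 7 * e * P.real (B i) * Y + P.real (B i) * (((1 + 7 * e) ^ s.card - 1) * Z) :=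
            add_le_add h1 h2
        _ ≤ 7 * e * (P.real (B i) * ((1 + 7 * e) ^ s.card * Z)) +
              P.real (B i) * (((1 + 7 * e) ^ s.card - 1) * Z) := by
            rw [mul_assoc (7 * e)]; gcongr
        _ = ((1 + 7 * e) ^ (s.card + 1) - 1) * (P.real (B i) * Z) := by ring
  refine main.trans ?_
  have : s.card ≤ ℓ := by simpa using Finset.card_le_univ s
  have hZ : 0 ≤ (∏ j ∈ s, P.real (B j)) * P.real E :=
    mul_nonneg (Finset.prod_nonneg fun _ _ => measureReal_nonneg) measureReal_nonneg
  have hpow := pow_le_pow_right₀ (by linarith : 1 ≤ 1 + 7 * e) this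
  gcongr

theorem PsiMixing.eventually_blockMixing [IsProbabilityMeasure P] (h : PsiMixing P) (ℓ : ℕ)
    {η : ℝ} (hη : 0 < η) : ∀ᶠ m in atTop, BlockMixing P ℓ m η := by
  have hlim : Tendsto (fun e : ℝ => (1 + 7 * e) ^ ℓ - 1) (𝓝[>] 0) (𝓝 0) := by
    have : Continuous fun e : ℝ => (1 + 7 * e) ^ ℓ - 1 := by fun_prop
    have h0 := this.tendsto 0
    simp only [mul_zero, add_zero, one_pow, sub_self] at h0
    exact h0.mono_left nhdsWithin_le_nhds
  have hsmall : ∀ᶠ e : ℝ in 𝓝[>] 0, e < 1 / 2 :=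
    (gt_mem_nhds (by norm_num)).filter_mono nhdsWithin_le_nhds
  obtain ⟨e, he1, he2, he0⟩ :=
    ((hlim.eventually (gt_mem_nhds hη)).and (hsmall.and self_mem_nhdsWithin)).exists
  filter_upwards [h.eventually_mixingAt he0] with m hm
  exact (hm.blockMixing (le_of_lt he0) he2.le ℓ).mono he1.le

/-- Exponential decay of long words with letters of probability bounded away from `1`. -/
theorem PsiMixing.exists_decay [IsProbabilityMeasure P] (h : PsiMixing P) (ω : ℕ → 𝒜) {q : ℝ} (hq1 : q < 1)
    (hq : ∀ i, P.real {x | x 0 = ω i} ≤ q) :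
    ∃ g : ℕ, 1 ≤ g ∧ ∃ θ : ℝ, 0 ≤ θ ∧ θ < 1 ∧ ∀ (b c J : ℕ) (E : Set (ℕ → 𝒜)),
      DeterminedBy (Set.Iio b) E →
        P.real (E ∩ shift^[b] ⁻¹' cyl (shift^[c] ω) (g * J)) ≤ θ ^ J * P.real E := by
  have hq0 : 0 ≤ q := measureReal_nonneg.trans (hq 0)
  obtain ⟨e, he0, he⟩ : ∃ e : ℝ, 0 < e ∧ (1 + e) * q < 1 := by
    refine ⟨(1 - q) / 2, by linarith, by nlinarith⟩
  obtain ⟨m, hm⟩ := (h.eventually_mixingAt he0).exists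
  refine ⟨m + 1, by omega, (1 + e) * q, by positivity, he, fun b c J E hE => ?_⟩
  induction J with
  | zero => simp [cyl]
  | succ J ih =>
    set E' := E ∩ shift^[b] ⁻¹' cyl (shift^[c] ω) ((m + 1) * J)
    -- Only the last letter of each stretch of `m + 1` is used. The `m` letters before it provide
    -- the mixing gap, and the letter costs a factor `(1 + e) * q < 1`.
    set F : Set (ℕ → 𝒜) := {x | x 0 = ω (c + ((m + 1) * J + m))}
    have hF : MeasurableSet F :=
      (measurable_pi_apply (X := fun _ => 𝒜) 0)
        (MeasurableSet.of_discrete (s := {ω (c + ((m + 1) * J + m))}))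
    have hE' : DeterminedBy (Set.Iio (b + (m + 1) * J)) E' :=
      (hE.mono fun i hi => by simp only [Set.mem_Iio] at *; omega).inter
        (((determinedBy_cyl _ _).preimage_shift _).mono fun i hi => hi.2)
    have hsub : E ∩ shift^[b] ⁻¹' cyl (shift^[c] ω) ((m + 1) * (J + 1)) ⊆
        E' ∩ shift^[b + (m + 1) * J + m] ⁻¹' F := by
      rintro x ⟨hxE, hx⟩
      refine ⟨⟨hxE, cyl_anti _ (Nat.mul_le_mul_left _ (Nat.le_succ J)) hx⟩, ?_⟩
      have := hx ((m + 1) * J + m) (by rw [mul_add]; omega)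
      rw [shift_iterate_apply, shift_iterate_apply] at this
      simp only [Set.mem_preimage, F, Set.mem_ofPred_eq]
      rw [shift_iterate_apply, ← this]
      congr 1
      ring
    have h1 := (abs_le.1 (hm m le_rfl _ E' F hE' hF)).2
    have h2 : P.real F ≤ q := hq _
    calc P.real (E ∩ shift^[b] ⁻¹' cyl (shift^[c] ω) ((m + 1) * (J + 1)))
        ≤ P.real (E' ∩ shift^[b + (m + 1) * J + m] ⁻¹' F) := measureReal_mono hsub
      _ ≤ (1 + e) * P.real F * P.real E' := by linarith
      _ ≤ (1 + e) * q * P.real E' := by gcongr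
      _ ≤ (1 + e) * q * (((1 + e) * q) ^ J * P.real E) := by gcongr
      _ = ((1 + e) * q) ^ (J + 1) * P.real E := by ring

end mixing

end

/-! ### Generating functions restricted to events. -/

section

section generatingFunction

variable {Ω : Type*} [MeasurableSpace Ω] {P : Measure Ω} [IsProbabilityMeasure P]

theorem integrable_pow_of_measurable {W : Ω → ℕ} (hW : Measurable W) {z : ℝ} (hz0 : 0 ≤ z)
    (hz1 : z ≤ 1) : Integrable (fun x => z ^ W x) P := by
  refine Integrable.of_bound (C := 1) ?_ (ae_of_all _ fun x => ?_)
  · exact ((measurable_from_top (f := fun k : ℕ => z ^ k)).comp hW).aestronglyMeasurable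
  · rw [Real.norm_of_nonneg (pow_nonneg hz0 _)]
    exact pow_le_one₀ hz0 hz1

theorem setIntegral_pow_eq_sum {W : Ω → ℕ} (hW : Measurable W) {M : ℕ} (hM : ∀ x, W x ≤ M)
    (D : Set Ω) (z : ℝ) :
    ∫ x in D, z ^ W x ∂P = ∑ v ∈ Finset.range (M + 1), z ^ v * P.real (D ∩ W ⁻¹' {v}) := by
  have hpt : (fun x => z ^ W x) =
      fun x => ∑ v ∈ Finset.range (M + 1), (W ⁻¹' {v}).indicator (fun _ => z ^ v) x := by
    funext x
    rw [Finset.sum_eq_single (W x)]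
    · simp
    · intro v _ hv
      exact Set.indicator_of_notMem (fun h => hv (Eq.symm h)) _
    · intro h
      exact absurd (Finset.mem_range.2 (Nat.lt_succ_of_le (hM x))) h
  rw [hpt, integral_finsetSum]
  · refine Finset.sum_congr rfl fun v _ => ?_
    rw [setIntegral_indicator (hW (measurableSet_singleton v)), setIntegral_const, smul_eq_mul,
      mul_comm]
  · exact fun v _ => (integrable_const _).indicator (hW (measurableSet_singleton v))

theorem integral_pow_mem_Icc {W : Ω → ℕ} (hW : Measurable W) {z : ℝ} (hz0 : 0 ≤ z)
    (hz1 : z ≤ 1) : ∫ x, z ^ W x ∂P ∈ Set.Icc (0 : ℝ) 1 := by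
  refine ⟨integral_nonneg fun x => pow_nonneg hz0 _, ?_⟩
  calc ∫ x, z ^ W x ∂P ≤ ∫ _, (1 : ℝ) ∂P :=
        integral_mono (integrable_pow_of_measurable hW hz0 hz1) (integrable_const _)
          fun x => pow_le_one₀ hz0 hz1
    _ = 1 := by simp

/-- Near independence of `D` from each level set of `W` passes to `z ^ W` by summation over the
finitely many values. -/
theorem abs_setIntegral_pow_sub_le {W : Ω → ℕ} (hW : Measurable W) {M : ℕ} (hM : ∀ x, W x ≤ M)
    {D : Set Ω} {z : ℝ} (hz0 : 0 ≤ z) (hz1 : z ≤ 1) {c η : ℝ} (hc : 0 ≤ c)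
    (hη : 0 ≤ η) (h : ∀ v, |P.real (D ∩ W ⁻¹' {v}) - c * P.real (W ⁻¹' {v})| ≤
      η * (c * P.real (W ⁻¹' {v}))) :
    |∫ x in D, z ^ W x ∂P - c * ∫ x, z ^ W x ∂P| ≤ η * c := by
  have h1 := (integral_pow_mem_Icc (P := P) hW hz0 hz1).2
  have h2 : ∫ x, z ^ W x ∂P = ∑ v ∈ Finset.range (M + 1), z ^ v * P.real (W ⁻¹' {v}) := by
    have := setIntegral_pow_eq_sum (P := P) hW hM Set.univ z
    simpa using this
  calc |∫ x in D, z ^ W x ∂P - c * ∫ x, z ^ W x ∂P|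
      = |∑ v ∈ Finset.range (M + 1),
          z ^ v * (P.real (D ∩ W ⁻¹' {v}) - c * P.real (W ⁻¹' {v}))| := by
        rw [setIntegral_pow_eq_sum hW hM D, h2, Finset.mul_sum, ← Finset.sum_sub_distrib]
        congr 1
        exact Finset.sum_congr rfl fun v _ => by ring
    _ ≤ ∑ v ∈ Finset.range (M + 1), z ^ v * (η * (c * P.real (W ⁻¹' {v}))) := by
        refine (Finset.abs_sum_le_sum_abs _ _).trans (Finset.sum_le_sum fun v _ => ?_)
        rw [abs_mul, abs_of_nonneg (pow_nonneg hz0 v)]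
        exact mul_le_mul_of_nonneg_left (h v) (pow_nonneg hz0 v)
    _ = η * c * ∫ x, z ^ W x ∂P := by
        rw [h2, Finset.mul_sum]
        exact Finset.sum_congr rfl fun v _ => by ring
    _ ≤ η * c := mul_le_of_le_one_right (by positivity) h1

end generatingFunction

/-! ### The telescoping coefficients. -/

/-- The coefficients with `z ^ b = ∑ a ≤ b, gapCoeff z a`. -/
noncomputable def gapCoeff (z : ℝ) (a : ℕ) : ℝ := if a = 0 then 1 else z ^ a - z ^ (a - 1)

theorem gapCoeff_zero (z : ℝ) : gapCoeff z 0 = 1 := if_pos rfl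

theorem gapCoeff_succ (z : ℝ) (a : ℕ) : gapCoeff z (a + 1) = z ^ (a + 1) - z ^ a := by
  simp [gapCoeff]

theorem gapCoeff_succ_nonpos {z : ℝ} (hz0 : 0 ≤ z) (hz1 : z ≤ 1) (a : ℕ) :
    gapCoeff z (a + 1) ≤ 0 := by
  rw [gapCoeff_succ]
  exact sub_nonpos.2 (pow_le_pow_of_le_one hz0 hz1 (Nat.le_succ a))

theorem sum_gapCoeff (z : ℝ) (Q : ℕ) : ∑ a ∈ Finset.range (Q + 1), gapCoeff z a = z ^ Q := by
  induction Q with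
  | zero => simp [gapCoeff]
  | succ Q ih => rw [Finset.sum_range_succ, ih, gapCoeff_succ]; ring

theorem sum_abs_gapCoeff_le {z : ℝ} (hz0 : 0 ≤ z) (hz1 : z ≤ 1) (Q : ℕ) :
    ∑ a ∈ Finset.range (Q + 1), |gapCoeff z a| ≤ 2 := by
  have h := sum_gapCoeff z Q
  rw [Finset.sum_range_succ', gapCoeff_zero] at h ⊢
  rw [Finset.sum_congr rfl fun a _ => abs_of_nonpos (gapCoeff_succ_nonpos hz0 hz1 a),
    Finset.sum_neg_distrib, abs_one]
  linarith [pow_nonneg hz0 Q]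

/-- All coefficients after the first are nonpositive and the total is `z ^ Q`, so damping them by
factors in `[0, 1]` leaves the sum between `z ^ Q` and `1`. -/
theorem sum_gapCoeff_mul_mem_Icc {z : ℝ} (hz0 : 0 ≤ z) (hz1 : z ≤ 1) (Q : ℕ) {R : ℕ → ℝ}
    (hR0 : R 0 = 1) (hR : ∀ a, R a ∈ Set.Icc (0 : ℝ) 1) :
    ∑ a ∈ Finset.range (Q + 1), gapCoeff z a * R a ∈ Set.Icc (0 : ℝ) 1 := by
  have h := sum_gapCoeff z Q
  rw [Finset.sum_range_succ', gapCoeff_zero] at h ⊢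
  rw [hR0]
  have h1 : ∑ a ∈ Finset.range Q, gapCoeff z (a + 1) ≤
      ∑ a ∈ Finset.range Q, gapCoeff z (a + 1) * R (a + 1) :=
    Finset.sum_le_sum fun a _ => by
      nlinarith [gapCoeff_succ_nonpos hz0 hz1 a, (hR (a + 1)).2]
  have h2 : ∑ a ∈ Finset.range Q, gapCoeff z (a + 1) * R (a + 1) ≤ 0 :=
    Finset.sum_nonpos fun a _ =>
      mul_nonpos_of_nonpos_of_nonneg (gapCoeff_succ_nonpos hz0 hz1 a) (hR (a + 1)).1
  constructor <;> linarith [pow_nonneg hz0 Q]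

/-- The property `p` holds exactly on an initial segment, so the sum telescopes to `z` raised to the
last index of that segment. -/
theorem sum_gapCoeff_indicator {z : ℝ} {p : ℕ → Prop} [DecidablePred p] (h0 : p 0) (Q : ℕ)
    (hp : ∀ a < Q, p (a + 1) → p a) :
    ∑ a ∈ Finset.range (Q + 1), (if p a then gapCoeff z a else 0) =
      z ^ ((Finset.Icc 1 Q).filter p).card := by
  induction Q with
  | zero => simp [h0, gapCoeff_zero]
  | succ Q ih =>
    rw [Finset.sum_range_succ, ih fun a ha => hp a (by omega),
      ← Finset.insert_Icc_right_eq_Icc_add_one (by omega), Finset.filter_insert]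
    by_cases hQ : p (Q + 1)
    · have hall : ∀ b a, a + b = Q + 1 → p a := by
        intro b
        induction b with
        | zero => intro a ha; rwa [show a = Q + 1 by omega]
        | succ b ihb => exact fun a ha => hp a (by omega) (ihb (a + 1) (by omega))
      have hcard : ((Finset.Icc 1 Q).filter p).card = Q := by
        rw [Finset.filter_true_of_mem fun a ha => hall (Q + 1 - a) a (by
          have := (Finset.mem_Icc.1 ha).2; omega)]
        simp
      rw [if_pos hQ, if_pos hQ, Finset.card_insert_of_notMem (by simp), hcard, gapCoeff_succ]
      ring
    · rw [if_neg hQ, if_neg hQ, add_zero]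

theorem abs_pow_add_sub_pow_le {z : ℝ} (hz0 : 0 ≤ z) (hz1 : z ≤ 1) (a b : ℕ) :
    |z ^ (a + b) - z ^ a| ≤ b := by
  rcases Nat.eq_zero_or_pos b with rfl | hb
  · simp
  · have h1 : z ^ a ≤ 1 := pow_le_one₀ hz0 hz1
    have h2 : z ^ (a + b) ≤ 1 := pow_le_one₀ hz0 hz1
    have h3 : (1 : ℝ) ≤ b := by exact_mod_cast hb
    rw [abs_le]
    constructor <;> linarith [pow_nonneg hz0 a, pow_nonneg hz0 (a + b)]

/-! ### Counting multiple returns. -/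

variable {𝒜 : Type*} {ℓ : ℕ}

/-- The multiple return to `A` at time `k`. -/
def multiReturn (d : Fin ℓ → ℕ) (A : Set (ℕ → 𝒜)) (k : ℕ) : Set (ℕ → 𝒜) :=
  ⋂ j, shift^[d j * k] ⁻¹' A

open Classical in
/-- The number of multiple returns to `A` at times in `s`. -/
noncomputable def hitCount (d : Fin ℓ → ℕ) (A : Set (ℕ → 𝒜)) (s : Finset ℕ) (x : ℕ → 𝒜) : ℕ :=
  (s.filter fun k => x ∈ multiReturn d A k).card

theorem hitCount_eq_sum (d : Fin ℓ → ℕ) (A : Set (ℕ → 𝒜)) (s : Finset ℕ) (x : ℕ → 𝒜) :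
    hitCount d A s x = ∑ k ∈ s, (multiReturn d A k).indicator (fun _ => 1) x := by
  classical
  rw [hitCount, Finset.card_filter]
  exact Finset.sum_congr rfl fun k _ => by simp [Set.indicator_apply]

theorem returnCount_eq_hitCount (d : Fin ℓ → ℕ) (A : Set (ℕ → 𝒜)) (N : ℕ) :
    returnCount d A N = hitCount d A (Finset.Icc 1 N) := by
  classical
  funext x
  rw [hitCount_eq_sum, returnCount]
  refine Finset.sum_congr rfl fun k _ => ?_
  by_cases h : x ∈ multiReturn d A k
  · rw [Set.indicator_of_mem h]
    exact Finset.prod_eq_one fun j _ => Set.indicator_of_mem (s := A) (Set.mem_iInter.1 h j) _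
  · rw [Set.indicator_of_notMem h]
    obtain ⟨j, hj⟩ : ∃ j, shift^[d j * k] x ∉ A := by
      simpa [multiReturn] using h
    exact Finset.prod_eq_zero (Finset.mem_univ j) (Set.indicator_of_notMem hj _)

theorem hitCount_le (d : Fin ℓ → ℕ) (A : Set (ℕ → 𝒜)) (s : Finset ℕ) (x : ℕ → 𝒜) :
    hitCount d A s x ≤ s.card := by
  classical exact Finset.card_filter_le _ _

theorem hitCount_union (d : Fin ℓ → ℕ) (A : Set (ℕ → 𝒜)) {s s' : Finset ℕ} (h : Disjoint s s')
    (x : ℕ → 𝒜) : hitCount d A (s ∪ s') x = hitCount d A s x + hitCount d A s' x := by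
  simp only [hitCount_eq_sum]
  exact Finset.sum_union h

section measurability

variable [MeasurableSpace 𝒜] {d : Fin ℓ → ℕ} {A : Set (ℕ → 𝒜)}

theorem measurableSet_multiReturn (hA : MeasurableSet A) (k : ℕ) :
    MeasurableSet (multiReturn d A k) :=
  MeasurableSet.iInter fun _ => measurable_shift.iterate _ hA

theorem measurable_hitCount (hA : MeasurableSet A) (s : Finset ℕ) :
    Measurable (hitCount d A s) := by
  rw [funext (hitCount_eq_sum d A s)]
  exact Finset.measurable_fun_sum _ fun k _ =>
    measurable_const.indicator (measurableSet_multiReturn hA k)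

variable {P : Measure (ℕ → 𝒜)} [IsProbabilityMeasure P]

/-- Pointwise, `z ^ W` changes by at most the number of added hits. This is the tool for discarding
times from a count at the price of their expected number. -/
theorem abs_setIntegral_pow_hitCount_union_sub_le (hA : MeasurableSet A) {s s' : Finset ℕ}
    (h : Disjoint s s') (D : Set (ℕ → 𝒜)) {z : ℝ} (hz0 : 0 ≤ z) (hz1 : z ≤ 1) :
    |∫ x in D, z ^ hitCount d A (s ∪ s') x ∂P - ∫ x in D, z ^ hitCount d A s x ∂P| ≤
      ∑ k ∈ s', P.real (multiReturn d A k ∩ D) := by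
  have hint : ∀ s : Finset ℕ, Integrable (fun x => z ^ hitCount d A s x) (P.restrict D) :=
    fun s => (integrable_pow_of_measurable (measurable_hitCount hA s) hz0 hz1).integrableOn
  have hind : ∀ k ∈ s', Integrable ((multiReturn d A k).indicator fun _ => (1 : ℝ))
      (P.restrict D) :=
    fun k _ => (integrable_const _).indicator (measurableSet_multiReturn hA k)
  have hsum : ∑ k ∈ s', P.real (multiReturn d A k ∩ D) =
      ∫ x in D, ∑ k ∈ s', (multiReturn d A k).indicator (fun _ => (1 : ℝ)) x ∂P := by
    rw [integral_finsetSum _ hind]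
    refine Finset.sum_congr rfl fun k _ => ?_
    rw [integral_indicator (measurableSet_multiReturn hA k), setIntegral_const, smul_eq_mul,
      mul_one, measureReal_restrict_apply (measurableSet_multiReturn hA k)]
  rw [hsum, ← integral_sub (hint _) (hint _)]
  refine abs_integral_le_integral_abs.trans ?_
  refine integral_mono ((hint _).sub (hint _)).abs (integrable_finsetSum _ hind) fun x => ?_
  refine le_of_le_of_eq (b := (hitCount d A s' x : ℝ)) ?_ ?_
  · simp only [hitCount_union d A h]
    exact abs_pow_add_sub_pow_le hz0 hz1 _ _
  · rw [hitCount_eq_sum]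
    push_cast
    refine Finset.sum_congr rfl fun k _ => ?_
    by_cases hk : x ∈ multiReturn d A k <;> simp [hk]

end measurability

end

/-! ### Periodicity and the structure of overlapping returns. -/

section

variable {𝒜 : Type*} {ℓ : ℕ}

theorem kappa_pos (d : Fin ℓ → ℕ) {r : ℕ} (hr : 1 ≤ r) : 1 ≤ kappa d r := by
  refine Nat.one_le_iff_ne_zero.2 fun h => ?_
  obtain ⟨j, -, hj⟩ := Finset.lcm_eq_zero_iff.1 h
  exact (Nat.div_pos (Nat.gcd_le_left _ hr) (Nat.gcd_pos_of_pos_left _ hr)).ne' hj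

theorem dvd_mul_kappa (d : Fin ℓ → ℕ) (r : ℕ) (j : Fin ℓ) : r ∣ d j * kappa d r := by
  have h1 : r / Nat.gcd r (d j) ∣ kappa d r :=
    Finset.dvd_lcm (f := fun j => r / Nat.gcd r (d j)) (Finset.mem_univ j)
  calc r = Nat.gcd r (d j) * (r / Nat.gcd r (d j)) :=
        (Nat.mul_div_cancel' (Nat.gcd_dvd_left _ _)).symm
    _ ∣ d j * kappa d r := mul_dvd_mul (Nat.gcd_dvd_right _ _) h1

/-- After division by `gcd (r, d_j)` the two quotients are coprime, so each `r / gcd (r, d_j)`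
divides `δ`. -/
theorem kappa_dvd {d : Fin ℓ → ℕ} {r δ : ℕ} (hr : 1 ≤ r) (h : ∀ j, r ∣ d j * δ) :
    kappa d r ∣ δ := by
  refine Finset.lcm_dvd fun j _ => ?_
  have hg : 0 < Nat.gcd r (d j) := Nat.gcd_pos_of_pos_left _ hr
  refine (Nat.coprime_div_gcd_div_gcd hg).dvd_of_dvd_mul_left ?_
  refine Nat.dvd_of_mul_dvd_mul_left hg ?_
  rw [← mul_assoc, Nat.mul_div_cancel' (Nat.gcd_dvd_left _ _),
    Nat.mul_div_cancel' (Nat.gcd_dvd_right _ _)]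
  exact h j

/-- `ω` is periodic under the shift and its periods are the multiples of `r`. -/
def HasPeriods (ω : ℕ → 𝒜) (r : ℕ) : Prop :=
  (∀ s, r ∣ s → ∀ i, ω (s + i) = ω i) ∧ ∀ s, (∀ i, ω (s + i) = ω i) → r ∣ s

theorem hasPeriods_minimalPeriod (ω : ℕ → 𝒜) :
    HasPeriods ω (Function.minimalPeriod shift ω) := by
  constructor
  · intro s hs i
    have h : shift^[s] ω = ω := Function.isPeriodicPt_iff_minimalPeriod_dvd.2 hs
    rw [← shift_iterate_apply s ω i, h]
  · intro s hs
    refine Function.isPeriodicPt_iff_minimalPeriod_dvd.1 (funext fun i => ?_)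
    rw [shift_iterate_apply, hs]

theorem HasPeriods.apply_mod {ω : ℕ → 𝒜} {r : ℕ} (h : HasPeriods ω r) (i : ℕ) :
    ω (i % r) = ω i := by
  conv_rhs => rw [← Nat.div_add_mod i r]
  exact (h.1 _ (dvd_mul_right _ _) _).symm

/-- The overlap has length at least `r`, hence meets every residue class mod `r`. Agreement on it
therefore makes `s` a period of all of `ω`. -/
theorem HasPeriods.dvd_of_overlap {ω : ℕ → 𝒜} {r n s : ℕ} (h : HasPeriods ω r) (hr : 1 ≤ r)
    (hs : s + r ≤ n) (hov : ∀ i, s + i < n → ω (s + i) = ω i) : r ∣ s := by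
  refine h.2 s fun i => ?_
  have hi : i % r < r := Nat.mod_lt _ hr
  have := hov (i % r) (by omega)
  rw [h.apply_mod i] at this
  rw [← this]
  conv_lhs => rw [← Nat.div_add_mod i r]
  rw [show s + (r * (i / r) + i % r) = r * (i / r) + (s + i % r) by ring]
  exact h.1 _ (dvd_mul_right _ _) _

/-- A run of `a + 1` multiple returns to `cyl ω n`, spaced by `q`, the last one at time `k`. -/
def runEvent (d : Fin ℓ → ℕ) (ω : ℕ → 𝒜) (n q k a : ℕ) : Set (ℕ → 𝒜) :=
  ⋂ j, shift^[d j * (k - a * q)] ⁻¹' cyl ω (n + d j * (a * q))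

theorem mem_runEvent {d : Fin ℓ → ℕ} {ω : ℕ → 𝒜} {n q k a : ℕ} {x : ℕ → 𝒜} :
    x ∈ runEvent d ω n q k a ↔
      ∀ j, ∀ i < n + d j * (a * q), x (d j * (k - a * q) + i) = ω i := by
  simp [runEvent, cyl, shift_iterate_apply]

theorem mem_multiReturn_cyl {d : Fin ℓ → ℕ} {ω : ℕ → 𝒜} {n k : ℕ} {x : ℕ → 𝒜} :
    x ∈ multiReturn d (cyl ω n) k ↔ ∀ j, ∀ i < n, x (d j * k + i) = ω i := by
  simp [multiReturn, cyl, shift_iterate_apply]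

theorem runEvent_zero (d : Fin ℓ → ℕ) (ω : ℕ → 𝒜) (n q k : ℕ) :
    runEvent d ω n q k 0 = multiReturn d (cyl ω n) k := by
  simp [runEvent, multiReturn]

/-- Removing early returns from a run shifts the start of the `j`-th block by a multiple of `d_j *
κ`, hence of `r`, so a shorter run is the tail of a longer one. -/
theorem runEvent_subset {d : Fin ℓ → ℕ} {ω : ℕ → 𝒜} {r : ℕ} (h : HasPeriods ω r) {n k a b : ℕ}
    (hab : a ≤ b) (hb : b * kappa d r ≤ k) :
    runEvent d ω n (kappa d r) k b ⊆ runEvent d ω n (kappa d r) k a := by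
  intro x hx
  rw [mem_runEvent] at hx ⊢
  intro j i hi
  obtain ⟨c, rfl⟩ := Nat.exists_eq_add_of_le hab
  have hk : k - a * kappa d r = (k - (a + c) * kappa d r) + c * kappa d r := by
    rw [add_mul] at *; omega
  have hx' := hx j (d j * (c * kappa d r) + i) (by
    rw [add_mul, mul_add]; omega)
  rw [hk, mul_add, add_assoc, hx']
  refine h.1 _ ?_ i
  rw [mul_left_comm]
  exact Dvd.dvd.mul_left (dvd_mul_kappa d r j) c

/-- The two copies of the word overlap in at least `r` letters for every `j`, which forces `r ∣ d_j
* δ`. The copies then fit together into one long prefix of `ω`, that is, a run. -/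
theorem mem_multiReturn_sub_iff {d : Fin ℓ → ℕ} {ω : ℕ → 𝒜} {r : ℕ} (h : HasPeriods ω r)
    (hr : 1 ≤ r) {n k δ : ℕ} (hδ : ∀ j, d j * δ + r ≤ n) (hδk : δ ≤ k) {x : ℕ → 𝒜}
    (hx : x ∈ multiReturn d (cyl ω n) k) :
    x ∈ multiReturn d (cyl ω n) (k - δ) ↔
      kappa d r ∣ δ ∧ x ∈ runEvent d ω n (kappa d r) k (δ / kappa d r) := by
  rw [mem_multiReturn_cyl] at hx ⊢
  have hk : ∀ j, d j * k = d j * (k - δ) + d j * δ := fun j => by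
    rw [← mul_add, Nat.sub_add_cancel hδk]
  constructor
  · intro hx'
    have hdvd : ∀ j, r ∣ d j * δ := fun j => by
      refine h.dvd_of_overlap hr (hδ j) fun i hi => ?_
      rw [← hx' j _ hi, ← hx j i (by omega), hk j, add_assoc]
    have hκ := kappa_dvd hr hdvd
    refine ⟨hκ, mem_runEvent.2 fun j i hi => ?_⟩
    rw [Nat.div_mul_cancel hκ] at hi ⊢
    by_cases hin : i < n
    · exact hx' j i hin
    · have hle := hδ j
      obtain ⟨i', rfl⟩ := Nat.exists_eq_add_of_le (show d j * δ ≤ i by omega)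
      rw [← add_assoc, ← hk j, hx j i' (by omega), h.1 _ (hdvd j)]
  · rintro ⟨hκ, hrun⟩ j i hi
    rw [mem_runEvent] at hrun
    have := hrun j i (by omega)
    rwa [Nat.div_mul_cancel hκ] at this

-- On a return at `k`, the previous returns within distance `H` are exactly those at `k - a * κ` for
-- which the run of index `a` occurs. The runs are nested in `a`, so the telescoping identity for
-- initial segments applies.
open Classical in
theorem pow_hitCount_near {d : Fin ℓ → ℕ} {ω : ℕ → 𝒜} {r : ℕ} (h : HasPeriods ω r)
    (hr : 1 ≤ r) {n k H : ℕ} (hH : ∀ j, d j * H + r ≤ n) (hHk : H ≤ k) {x : ℕ → 𝒜}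
    (hx : x ∈ multiReturn d (cyl ω n) k) (z : ℝ) :
    z ^ hitCount d (cyl ω n) (Finset.Ico (k - H) k) x =
      ∑ a ∈ Finset.range (H / kappa d r + 1),
        if x ∈ runEvent d ω n (kappa d r) k a then gapCoeff z a else 0 := by
  have hκ := kappa_pos d hr
  have hmul : ∀ a ≤ H / kappa d r, a * kappa d r ≤ H := fun a ha =>
    (Nat.mul_le_mul_right _ ha).trans (Nat.div_mul_le_self _ _)
  rw [sum_gapCoeff_indicator (by rwa [runEvent_zero])]
  · congr 1
    symm
    have hiff : ∀ δ ≤ H, (x ∈ multiReturn d (cyl ω n) (k - δ) ↔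
        kappa d r ∣ δ ∧ x ∈ runEvent d ω n (kappa d r) k (δ / kappa d r)) := fun δ hδ =>
      mem_multiReturn_sub_iff h hr
        (fun j => (Nat.add_le_add_right (Nat.mul_le_mul_left _ hδ) r).trans (hH j))
        (hδ.trans hHk) hx
    refine Finset.card_nbij' (fun a => k - a * kappa d r) (fun k' => (k - k') / kappa d r)
      ?_ ?_ ?_ ?_
    · intro a ha
      simp only [Finset.coe_filter, Finset.mem_Icc, Set.mem_ofPred_eq, Finset.mem_Ico] at ha ⊢
      have h1 := hmul a ha.1.2
      have h2 : 1 * 1 ≤ a * kappa d r := Nat.mul_le_mul ha.1.1 hκ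
      refine ⟨by omega, (hiff _ h1).2 ⟨dvd_mul_left _ _, ?_⟩⟩
      rw [Nat.mul_div_cancel _ hκ]
      exact ha.2
    · intro k' hk'
      simp only [Finset.coe_filter, Finset.mem_Icc, Set.mem_ofPred_eq, Finset.mem_Ico] at hk' ⊢
      have h1 := (hiff (k - k') (by omega)).1 (by
        rw [show k - (k - k') = k' by omega]; exact hk'.2)
      refine ⟨⟨?_, Nat.div_le_div_right (by omega)⟩, h1.2⟩
      exact Nat.div_pos (Nat.le_of_dvd (by omega) h1.1) hκ
    · intro a ha
      simp only [Finset.coe_filter, Finset.mem_Icc, Set.mem_ofPred_eq] at ha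
      have h1 := hmul a ha.1.2
      simp only
      rw [show k - (k - a * kappa d r) = a * kappa d r by omega, Nat.mul_div_cancel _ hκ]
    · intro k' hk'
      simp only [Finset.coe_filter, Set.mem_ofPred_eq, Finset.mem_Ico] at hk'
      have h1 := (hiff (k - k') (by omega)).1 (by
        rw [show k - (k - k') = k' by omega]; exact hk'.2)
      simp only
      rw [Nat.div_mul_cancel h1.1]
      omega
  · intro a ha hrun
    exact runEvent_subset h (Nat.le_succ a) ((hmul (a + 1) ha).trans hHk) hrun

/-- The times in `[K, k)` at which some return block comes close to a return block of time `k`. -/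
def relatedTimes (d : Fin ℓ → ℕ) (n K k : ℕ) : Finset ℕ :=
  (Finset.Ico K k).filter fun k' => ∃ i j, d i * k < d j * k' + 3 * n ∧ d j * k' < d i * k + 3 * n

/-- For each of the `ℓ²` pairs `(i, j)` the number `d_j * k'` lies in a window of at most `6 * n`
integers, and `k' ↦ d_j * k'` is injective. -/
theorem card_relatedTimes_le {d : Fin ℓ → ℕ} (hd : ∀ j, 1 ≤ d j) (n K k : ℕ) :
    (relatedTimes d n K k).card ≤ ℓ ^ 2 * (6 * n) := by
  have hsub : relatedTimes d n K k ⊆ (Finset.univ : Finset (Fin ℓ × Fin ℓ)).biUnion fun ij =>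
      (Finset.Ico K k).filter fun k' =>
        d ij.1 * k < d ij.2 * k' + 3 * n ∧ d ij.2 * k' < d ij.1 * k + 3 * n := by
    intro k' hk'
    rw [relatedTimes, Finset.mem_filter] at hk'
    obtain ⟨hk', i, j, hij⟩ := hk'
    exact Finset.mem_biUnion.2 ⟨(i, j), Finset.mem_univ _, Finset.mem_filter.2 ⟨hk', hij⟩⟩
  refine (Finset.card_le_card hsub).trans ?_
  have hcard : (Finset.univ : Finset (Fin ℓ × Fin ℓ)).card = ℓ ^ 2 := by simp [sq]
  rw [← hcard]
  refine Finset.card_biUnion_le_card_mul _ _ _ fun ij _ => ?_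
  calc _ ≤ (Finset.Ico (d ij.1 * k + 1 - 3 * n) (d ij.1 * k + 3 * n)).card := by
        refine Finset.card_le_card_of_injOn (fun k' => d ij.2 * k') ?_ ?_
        · intro k' hk'
          simp only [Finset.coe_filter, Set.mem_ofPred_eq, Finset.coe_Ico, Set.mem_Ico] at hk' ⊢
          omega
        · intro a _ b _ hab
          exact Nat.eq_of_mul_eq_mul_left (hd ij.2) hab
    _ ≤ 6 * n := by rw [Nat.card_Ico]; omega

end

/-! ### One return against its past: the clump estimate. -/

section

variable {𝒜 : Type*} {ℓ : ℕ}

theorem mul_add_le_mul_of_lt {a b : ℕ} (h : a < b) (k : ℕ) : a * k + k ≤ b * k := by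
  rw [← Nat.succ_mul]; exact Nat.mul_le_mul_right k h

theorem determinedBy_multiReturn (d : Fin ℓ → ℕ) (ω : ℕ → 𝒜) (n k : ℕ) {J : Set ℕ}
    (hJ : ∀ j, Set.Ico (d j * k) (d j * k + n) ⊆ J) :
    DeterminedBy J (multiReturn d (cyl ω n) k) :=
  DeterminedBy.iInter fun j => ((determinedBy_cyl ω n).preimage_shift _).mono (hJ j)

theorem determinedBy_hitCount {d : Fin ℓ → ℕ} {A : Set (ℕ → 𝒜)} {s : Finset ℕ} {J : Set ℕ}
    (h : ∀ k ∈ s, DeterminedBy J (multiReturn d A k)) (v : ℕ) :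
    DeterminedBy J (hitCount d A s ⁻¹' {v}) := by
  classical
  intro x y hxy hx
  have : hitCount d A s y = hitCount d A s x := by
    rw [hitCount, hitCount]
    congr 1
    exact Finset.filter_congr fun k hk => ((h k hk).iff hxy).symm
  exact this.trans hx

variable [MeasurableSpace 𝒜] {P : Measure (ℕ → 𝒜)} [IsProbabilityMeasure P]

theorem measureReal_multiReturn_le {d : Fin ℓ → ℕ} (hd : ∀ j, 1 ≤ d j)
    (hinj : Function.Injective d) {n : ℕ} {η : ℝ} (hblock : BlockMixing P ℓ n η) (hη : η ≤ 1)
    (ω : ℕ → 𝒜) {k : ℕ} (hk : 2 * n ≤ k) :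
    P.real (multiReturn d (cyl ω n) k) ≤ 2 * P.real (cyl ω n) ^ ℓ := by
  have := hblock.measureReal_le hη (fun j => d j * k) (fun _ => n) (fun _ => cyl ω n)
    (fun _ => determinedBy_cyl ω n) (fun j => by nlinarith [hd j]) (fun i j hij => by
      rcases lt_or_gt_of_ne (hinj.ne hij) with h | h
      · left; have := mul_add_le_mul_of_lt h k; omega
      · right; have := mul_add_le_mul_of_lt h k; omega)
  simpa [multiReturn] using this

/-- The last block of time `k` lies a gap `n` beyond every block of time `k'`, so it alone
contributes an extra factor `2 * p` to the bound `2 * p ^ ℓ`. -/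
theorem measureReal_multiReturn_inter_le_of_far [DiscreteMeasurableSpace 𝒜] {d : Fin ℓ → ℕ} (hd : ∀ j, 1 ≤ d j)
    (hinj : Function.Injective d) {n : ℕ} {η : ℝ} (hblock : BlockMixing P ℓ n η) (hη : η ≤ 1)
    (hmix : MixingAt P n 1) (ω : ℕ → 𝒜) {i : Fin ℓ} (hi : ∀ j, d j ≤ d i) {k' k : ℕ}
    (hk' : 2 * n ≤ k') (hk : d i * k' + 2 * n ≤ d i * k) :
    P.real (multiReturn d (cyl ω n) k' ∩ multiReturn d (cyl ω n) k) ≤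
      4 * P.real (cyl ω n) * P.real (cyl ω n) ^ ℓ := by
  set p := P.real (cyl ω n)
  have h1 := measureReal_multiReturn_le hd hinj hblock hη ω hk'
  have hdet : DeterminedBy (Set.Iio (d i * k' + n)) (multiReturn d (cyl ω n) k') :=
    determinedBy_multiReturn d ω n k' fun j x hx => by
      have := Nat.mul_le_mul_right k' (hi j)
      simp only [Set.mem_Ico, Set.mem_Iio] at *
      omega
  have h2 := (abs_le.1 (hmix (d i * k - (d i * k' + n)) (by omega) _ _ _ hdet
    (measurableSet_cyl ω n))).2
  rw [show d i * k' + n + (d i * k - (d i * k' + n)) = d i * k by omega] at h2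
  have h3 : P.real (multiReturn d (cyl ω n) k' ∩ multiReturn d (cyl ω n) k) ≤
      P.real (multiReturn d (cyl ω n) k' ∩ shift^[d i * k] ⁻¹' cyl ω n) :=
    measureReal_mono (Set.inter_subset_inter_right _ (Set.iInter_subset _ i))
  have hp : 0 ≤ p := measureReal_nonneg
  nlinarith [mul_le_mul_of_nonneg_left h1 hp]

/-- Here the last blocks of `k'` and `k` are close or overlap. The last block of `k'` and the other
blocks of `k` are well separated and give `2 * p ^ ℓ`; the part of the last block of `k` that sticks
out has at least `H` letters and gives the decay factor. -/
theorem measureReal_multiReturn_inter_le_of_mid {d : Fin ℓ → ℕ} (hd : ∀ j, 1 ≤ d j)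
    (hinj : Function.Injective d) {n : ℕ} {η : ℝ} (hblock : BlockMixing P ℓ n η) (hη : η ≤ 1)
    (ω : ℕ → 𝒜) {g : ℕ} {θ : ℝ} (hθ : 0 ≤ θ)
    (hdecay : ∀ (b c J : ℕ) (E : Set (ℕ → 𝒜)), DeterminedBy (Set.Iio b) E →
      P.real (E ∩ shift^[b] ⁻¹' cyl (shift^[c] ω) (g * J)) ≤ θ ^ J * P.real E)
    {i : Fin ℓ} (hi : ∀ j, d j ≤ d i) {k' k H : ℕ} (hk' : 4 * n ≤ k') (hkk' : k' ≤ k)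
    (hk : d i * k < d i * k' + 2 * n) (hH : k' + H ≤ k) (hHn : H ≤ n) :
    P.real (multiReturn d (cyl ω n) k' ∩ multiReturn d (cyl ω n) k) ≤
      2 * θ ^ (H / g) * P.real (cyl ω n) ^ ℓ := by
  -- A hybrid family of blocks. The bound `4 * n ≤ k'` keeps them `n` apart although block `i` is
  -- taken at the earlier time.
  let a : Fin ℓ → ℕ := fun j => if j = i then d i * k' else d j * k
  set E : Set (ℕ → 𝒜) := ⋂ j, shift^[a j] ⁻¹' cyl ω n
  have hlt : ∀ j, j ≠ i → d j < d i := fun j hj => lt_of_le_of_ne (hi j) (hinj.ne hj)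
  have hsep : ∀ j, j ≠ i → d j * k + k ≤ d i * k := fun j hj => mul_add_le_mul_of_lt (hlt j hj) k
  have hgap : d i * k' + H ≤ d i * k :=
    calc d i * k' + H ≤ d i * k' + d i * H := by nlinarith [hd i]
      _ = d i * (k' + H) := by ring
      _ ≤ d i * k := Nat.mul_le_mul_left _ hH
  have hE1 : P.real E ≤ 2 * P.real (cyl ω n) ^ ℓ := by
    have := hblock.measureReal_le hη a (fun _ => n) (fun _ => cyl ω n)
      (fun _ => determinedBy_cyl ω n) (fun j => by
        by_cases hj : j = i
        · simp only [a, hj, if_true]; nlinarith [hd i]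
        · simp only [a, hj, if_false]; nlinarith [hd j]) (fun j j' hjj' => by
        by_cases hj : j = i
        · have hj' : j' ≠ i := fun h => hjj' (hj.trans h.symm)
          have := hsep j' hj'
          simp only [a, hj, hj', if_true, if_false]; omega
        · by_cases hj' : j' = i
          · have := hsep j hj
            simp only [a, hj, hj', if_true, if_false]; omega
          · simp only [a, hj, hj', if_false]
            rcases lt_or_gt_of_ne (hinj.ne hjj') with h | h
            · left; have := mul_add_le_mul_of_lt h k; omega
            · right; have := mul_add_le_mul_of_lt h k; omega)
    simpa using this
  have hEdet : DeterminedBy (Set.Iio (d i * k' + n)) E :=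
    DeterminedBy.iInter fun j => ((determinedBy_cyl ω n).preimage_shift _).mono fun x hx => by
      by_cases hj : j = i
      · simp only [a, hj, if_true, Set.mem_Ico, Set.mem_Iio] at *; omega
      · have := hsep j hj
        simp only [a, hj, if_false, Set.mem_Ico, Set.mem_Iio] at *; omega
  -- The first position that is past all the chosen blocks and inside the last block of time `k`.
  set b := max (d i * k' + n) (d i * k)
  have hsub : multiReturn d (cyl ω n) k' ∩ multiReturn d (cyl ω n) k ⊆
      E ∩ shift^[b] ⁻¹' cyl (shift^[b - d i * k] ω) (g * (H / g)) := by
    rintro x ⟨hx', hx⟩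
    constructor
    · refine Set.mem_iInter.2 fun j => ?_
      by_cases hj : j = i
      · simp only [a, hj, if_true]; exact Set.mem_iInter.1 hx' i
      · simp only [a, hj, if_false]; exact Set.mem_iInter.1 hx j
    · intro s hs
      have hgH : g * (H / g) ≤ H := Nat.mul_div_le H g
      have hb : b + s < d i * k + n := by
        simp only [b]; omega
      have hb' : d i * k ≤ b := le_max_right _ _
      rw [mem_multiReturn_cyl] at hx
      have := hx i (b - d i * k + s) (by omega)
      rw [shift_iterate_apply, shift_iterate_apply, ← this]
      congr 1
      omega
  calc P.real (multiReturn d (cyl ω n) k' ∩ multiReturn d (cyl ω n) k)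
      ≤ P.real (E ∩ shift^[b] ⁻¹' cyl (shift^[b - d i * k] ω) (g * (H / g))) :=
        measureReal_mono hsub
    _ ≤ θ ^ (H / g) * P.real E :=
        hdecay _ _ _ _ (hEdet.mono (Set.Iio_subset_Iio (le_max_left _ _)))
    _ ≤ θ ^ (H / g) * (2 * P.real (cyl ω n) ^ ℓ) := by gcongr
    _ = 2 * θ ^ (H / g) * P.real (cyl ω n) ^ ℓ := by ring

/-- The approximate probability that a multiple return ends a clump, with weight `z` for each
earlier return of the clump. -/
noncomputable def clumpWeight (P : Measure (ℕ → 𝒜)) (d : Fin ℓ → ℕ) (ω : ℕ → 𝒜) (q n Q : ℕ)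
    (z : ℝ) : ℝ :=
  ∑ a ∈ Finset.range (Q + 1), gapCoeff z a * ∏ j, P.real (cyl ω (n + d j * (a * q)))

/-- The past of `k` splits into near times, described exactly by runs, far times, independent of the
runs up to `η`, and the remaining related times, which are few and are discarded. Every error
carries a factor `p ^ ℓ`, as needed for about `t / p ^ ℓ` iterations. -/
theorem abs_setIntegral_multiReturn_sub_le [Countable 𝒜] [DiscreteMeasurableSpace 𝒜]
    {d : Fin ℓ → ℕ} (hd : ∀ j, 1 ≤ d j)
    (hinj : Function.Injective d) {n : ℕ} {η : ℝ} (hblock : BlockMixing P ℓ n η) (hη0 : 0 ≤ η)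
    (hη : η ≤ 1) (hmix : MixingAt P n 1) {ω : ℕ → 𝒜} {r : ℕ} (hper : HasPeriods ω r) (hr : 1 ≤ r)
    {g : ℕ} {θ : ℝ} (hθ : 0 ≤ θ)
    (hdecay : ∀ (b c J : ℕ) (E : Set (ℕ → 𝒜)), DeterminedBy (Set.Iio b) E →
      P.real (E ∩ shift^[b] ⁻¹' cyl (shift^[c] ω) (g * J)) ≤ θ ^ J * P.real E)
    {i : Fin ℓ} (hi : ∀ j, d j ≤ d i) {k H : ℕ} (hH : d i * H + r ≤ n) (hk : 5 * n ≤ k)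
    {z : ℝ} (hz0 : 0 ≤ z) (hz1 : z ≤ 1) :
    |∫ x in multiReturn d (cyl ω n) k, z ^ hitCount d (cyl ω n) (Finset.Ico (4 * n) k) x ∂P -
      clumpWeight P d ω (kappa d r) n (H / kappa d r) z *
        ∫ x, z ^ hitCount d (cyl ω n) (Finset.Ico (4 * n) k) x ∂P| ≤
      (ℓ ^ 2 * (6 * n) * (8 * P.real (cyl ω n) + 2 * θ ^ (H / g)) + 2 * η) *
        P.real (cyl ω n) ^ ℓ := by
  classical
  set A := cyl ω n with hA
  set p := P.real A
  have hAm : MeasurableSet A := measurableSet_cyl ω n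
  have hℓ : 1 ≤ ℓ := by have := i.2; omega
  have hp0 : 0 ≤ p := measureReal_nonneg
  have hp1 : p ≤ 1 := measureReal_le_one
  have hHn : H ≤ n := by nlinarith [hd i]
  have hHj : ∀ j, d j * H + r ≤ n := fun j =>
    (Nat.add_le_add_right (Nat.mul_le_mul_right H (hi j)) r).trans hH
  set near := Finset.Ico (k - H) k
  set R := relatedTimes d n (4 * n) k
  set far := Finset.Ico (4 * n) k \ R
  have hnear : near ⊆ R := by
    intro k' hk'
    rw [Finset.mem_Ico] at hk'
    refine Finset.mem_filter.2 ⟨Finset.mem_Ico.2 ⟨by omega, hk'.2⟩, i, i, ?_, ?_⟩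
    · have : d i * k ≤ d i * k' + d i * H := by
        rw [← mul_add]; exact Nat.mul_le_mul_left _ (by omega)
      omega
    · have := Nat.mul_le_mul_left (d i) hk'.2.le
      omega
  have hRs : R ⊆ Finset.Ico (4 * n) k := Finset.filter_subset _ _
  have hdisj1 : Disjoint (near ∪ far) (R \ near) := by
    rw [Finset.disjoint_left]
    intro x hx hx'
    rw [Finset.mem_sdiff] at hx'
    rcases Finset.mem_union.1 hx with h | h
    · exact hx'.2 h
    · exact (Finset.mem_sdiff.1 h).2 hx'.1
  have hdisj2 : Disjoint near far := by
    rw [Finset.disjoint_left]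
    exact fun x hx hx' => (Finset.mem_sdiff.1 hx').2 (hnear hx)
  have hdisj3 : Disjoint far R := Finset.sdiff_disjoint
  have hunion1 : near ∪ far ∪ (R \ near) = Finset.Ico (4 * n) k := by
    ext x
    have h1 := @hnear x
    have h2 := @hRs x
    simp only [far, Finset.mem_union, Finset.mem_sdiff]
    tauto
  have hunion2 : far ∪ R = Finset.Ico (4 * n) k := Finset.sdiff_union_of_subset hRs
  have hcardR : (R.card : ℝ) ≤ ℓ ^ 2 * (6 * n) := by
    exact_mod_cast card_relatedTimes_le hd n (4 * n) k
  have hret : ∀ k', 4 * n ≤ k' → P.real (multiReturn d A k') ≤ 2 * p ^ ℓ := fun k' hk' =>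
    measureReal_multiReturn_le hd hinj hblock hη ω (by omega)
  have hpair : ∀ k' ∈ R \ near, P.real (multiReturn d A k' ∩ multiReturn d A k) ≤
      (4 * p + 2 * θ ^ (H / g)) * p ^ ℓ := by
    intro k' hk'
    rw [Finset.mem_sdiff] at hk'
    have hk1 := Finset.mem_Ico.1 (hRs hk'.1)
    have hk2 : k' + H ≤ k := by
      by_contra hcon
      exact hk'.2 (Finset.mem_Ico.2 ⟨by omega, hk1.2⟩)
    have hθH : 0 ≤ θ ^ (H / g) := pow_nonneg hθ _
    rw [add_mul]
    have hpℓ : 0 ≤ p ^ ℓ := pow_nonneg hp0 _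
    rcases le_or_gt (d i * k' + 2 * n) (d i * k) with h | h
    · have := measureReal_multiReturn_inter_le_of_far hd hinj hblock hη hmix ω hi
        (by omega) h
      have : 0 ≤ 2 * θ ^ (H / g) * p ^ ℓ := by positivity
      linarith
    · have := measureReal_multiReturn_inter_le_of_mid hd hinj hblock hη ω hθ hdecay hi hk1.1
        hk1.2.le h hk2 hHn
      have : 0 ≤ 4 * p * p ^ ℓ := by positivity
      linarith
  have hfar : ∀ k' ∈ far, ∀ i j, d j * k' + 3 * n ≤ d i * k ∨ d i * k + 3 * n ≤ d j * k' := by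
    intro k' hk' i j
    by_contra hcon
    push Not at hcon
    rw [Finset.mem_sdiff] at hk'
    exact hk'.2 (Finset.mem_filter.2 ⟨hk'.1, i, j, hcon.1, hcon.2⟩)
  set Q := H / kappa d r
  have hQ : ∀ a ∈ Finset.range (Q + 1), a * kappa d r ≤ H := fun a ha =>
    (Nat.mul_le_mul_right _ (Nat.lt_succ_iff.1 (Finset.mem_range.1 ha))).trans
      (Nat.div_mul_le_self _ _)
  -- The `j`-th block of a run starts at or after `d_j * k - n` and ends at `d_j * k + n`. The
  -- margin `3 * n` in the definition of related times thus leaves a gap `n` to every far return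
  -- block.
  have hindep : ∀ a ∈ Finset.range (Q + 1),
      |∫ x in runEvent d ω n (kappa d r) k a, z ^ hitCount d A far x ∂P -
        (∏ j, P.real (cyl ω (n + d j * (a * kappa d r)))) * ∫ x, z ^ hitCount d A far x ∂P| ≤
      η * ∏ j, P.real (cyl ω (n + d j * (a * kappa d r))) := by
    intro a ha
    have haH := hQ a ha
    have hend : ∀ j, d j * (k - a * kappa d r) + (n + d j * (a * kappa d r)) = d j * k + n := by
      intro j
      rw [add_left_comm, ← mul_add, Nat.sub_add_cancel (by omega), add_comm]
    have hlen : ∀ j, d j * (a * kappa d r) ≤ n := fun j =>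
      (Nat.mul_le_mul_left _ haH).trans (by have := hHj j; omega)
    have hdk : ∀ j, k ≤ d j * k := fun j => by nlinarith [hd j]
    refine abs_setIntegral_pow_sub_le (measurable_hitCount hAm far)
      (hitCount_le d A far) hz0 hz1
      (Finset.prod_nonneg fun _ _ => measureReal_nonneg) hη0 fun v => ?_
    have hB := hblock Finset.univ (fun j => d j * (k - a * kappa d r))
      (fun j => n + d j * (a * kappa d r)) (fun j => cyl ω (n + d j * (a * kappa d r)))
      (hitCount d A far ⁻¹' {v}) (fun j => determinedBy_cyl _ _)
      (fun j _ => by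
        have := hend j; have := hlen j; have := hdk j
        omega)
      (fun j _ j' _ hjj' => by
        have h1 := hend j; have h2 := hlen j; have h3 := hend j'; have h4 := hlen j'
        rcases lt_or_gt_of_ne (hinj.ne hjj') with h | h
        · left; have := mul_add_le_mul_of_lt h k
          omega
        · right; have := mul_add_le_mul_of_lt h k
          omega)
      (fun j _ => determinedBy_hitCount (fun k' hk' => determinedBy_multiReturn d ω n k'
        fun j' x hx => by
          have h1 := hend j; have h2 := hlen j
          have := hfar k' hk' j j'
          simp only [Set.mem_Ico, Set.mem_union, Set.mem_Iio, Set.mem_Ici] at hx ⊢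
          omega) v)
      (measurable_hitCount hAm far (measurableSet_singleton v))
    simp only [Finset.mem_univ, Set.iInter_true] at hB
    rw [Set.inter_comm]
    exact hB
  -- The near factor of `z ^ count` is expanded over runs, leaving the far factor under each run
  -- indicator.
  have hdecomp : ∫ x in multiReturn d A k, z ^ hitCount d A (near ∪ far) x ∂P =
      ∑ a ∈ Finset.range (Q + 1), gapCoeff z a *
        ∫ x in runEvent d ω n (kappa d r) k a, z ^ hitCount d A far x ∂P := by
    have hrunm : ∀ a, MeasurableSet (runEvent d ω n (kappa d r) k a) := fun a =>
      MeasurableSet.iInter fun j => measurable_shift.iterate _ (measurableSet_cyl _ _)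
    have hint := integrable_pow_of_measurable (P := P) (measurable_hitCount hAm far (d := d))
      hz0 hz1
    rw [← integral_indicator (measurableSet_multiReturn hAm k)]
    simp_rw [← integral_indicator (hrunm _), ← integral_const_mul]
    rw [← integral_finsetSum _ fun a _ => (hint.indicator (hrunm a)).const_mul _]
    congr 1
    funext x
    by_cases hx : x ∈ multiReturn d A k
    · rw [Set.indicator_of_mem hx, hitCount_union d A hdisj2, pow_add,
        pow_hitCount_near hper hr hHj (by omega) hx z, Finset.sum_mul]
      refine Finset.sum_congr rfl fun a _ => ?_
      by_cases hxa : x ∈ runEvent d ω n (kappa d r) k a <;> simp [hxa]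
    · rw [Set.indicator_of_notMem hx]
      refine (Finset.sum_eq_zero fun a ha => ?_).symm
      have : x ∉ runEvent d ω n (kappa d r) k a := fun h => hx (by
        have := runEvent_subset hper (Nat.zero_le a) ((hQ a ha).trans (by omega)) h
        rwa [runEvent_zero] at this)
      rw [Set.indicator_of_notMem this, mul_zero]
  have hstep1 : |∫ x in multiReturn d A k, z ^ hitCount d A (Finset.Ico (4 * n) k) x ∂P -
      ∫ x in multiReturn d A k, z ^ hitCount d A (near ∪ far) x ∂P| ≤
      ℓ ^ 2 * (6 * n) * ((4 * p + 2 * θ ^ (H / g)) * p ^ ℓ) := by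
    rw [← hunion1]
    refine (abs_setIntegral_pow_hitCount_union_sub_le hAm hdisj1 _ hz0 hz1).trans ?_
    refine (Finset.sum_le_sum hpair).trans ?_
    rw [Finset.sum_const, nsmul_eq_mul]
    have h1 : ((R \ near).card : ℝ) ≤ ℓ ^ 2 * (6 * n) :=
      le_trans (by exact_mod_cast Finset.card_le_card Finset.sdiff_subset) hcardR
    have hθH : 0 ≤ θ ^ (H / g) := pow_nonneg hθ _
    gcongr
  -- Without conditioning on a return at `k`, all related times can be put back at small cost.
  have hstep2 : |∫ x, z ^ hitCount d A far x ∂P -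
      ∫ x, z ^ hitCount d A (Finset.Ico (4 * n) k) x ∂P| ≤ ℓ ^ 2 * (6 * n) * (2 * p ^ ℓ) := by
    have := abs_setIntegral_pow_hitCount_union_sub_le (P := P) (d := d) hAm hdisj3 Set.univ
      hz0 hz1
    rw [hunion2] at this
    simp only [Measure.restrict_univ, Set.inter_univ] at this
    rw [abs_sub_comm]
    refine this.trans ?_
    refine (Finset.sum_le_sum fun k' hk' => hret k' (Finset.mem_Ico.1 (hRs hk')).1).trans ?_
    rw [Finset.sum_const, nsmul_eq_mul]
    gcongr
  have hprod : ∀ a, ∏ j, P.real (cyl ω (n + d j * (a * kappa d r))) ≤ p ^ ℓ := by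
    intro a
    calc ∏ j, P.real (cyl ω (n + d j * (a * kappa d r))) ≤ ∏ _j : Fin ℓ, p :=
          Finset.prod_le_prod (fun _ _ => measureReal_nonneg) fun j _ =>
            measureReal_mono (cyl_anti ω (Nat.le_add_right _ _))
      _ = p ^ ℓ := by simp
  have hpp : p ^ ℓ ≤ p := pow_le_of_le_one hp0 hp1 (by omega)
  have hstep3 : |∑ a ∈ Finset.range (Q + 1), gapCoeff z a *
        ∫ x in runEvent d ω n (kappa d r) k a, z ^ hitCount d A far x ∂P -
      clumpWeight P d ω (kappa d r) n Q z *
        ∫ x, z ^ hitCount d A (Finset.Ico (4 * n) k) x ∂P| ≤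
      2 * ((η + ℓ ^ 2 * (6 * n) * (2 * p ^ ℓ)) * p ^ ℓ) := by
    rw [clumpWeight, Finset.sum_mul, ← Finset.sum_sub_distrib]
    refine (Finset.abs_sum_le_sum_abs _ _).trans ?_
    calc _ ≤ ∑ a ∈ Finset.range (Q + 1), |gapCoeff z a| *
          ((η + ℓ ^ 2 * (6 * n) * (2 * p ^ ℓ)) * p ^ ℓ) := by
          refine Finset.sum_le_sum fun a ha => ?_
          rw [mul_assoc, ← mul_sub, abs_mul]
          refine mul_le_mul_of_nonneg_left ?_ (abs_nonneg _)
          set c := ∏ j, P.real (cyl ω (n + d j * (a * kappa d r)))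
          have hc0 : 0 ≤ c := Finset.prod_nonneg fun _ _ => measureReal_nonneg
          refine (abs_sub_le _ (c * ∫ x, z ^ hitCount d A far x ∂P) _).trans ?_
          rw [← mul_sub, abs_mul, abs_of_nonneg hc0]
          calc _ ≤ η * c + c * (ℓ ^ 2 * (6 * n) * (2 * p ^ ℓ)) :=
                add_le_add (hindep a ha) (mul_le_mul_of_nonneg_left hstep2 hc0)
            _ = (η + ℓ ^ 2 * (6 * n) * (2 * p ^ ℓ)) * c := by ring
            _ ≤ _ := mul_le_mul_of_nonneg_left (hprod a) (by positivity)
      _ ≤ _ := by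
          rw [← Finset.sum_mul]
          exact mul_le_mul_of_nonneg_right (sum_abs_gapCoeff_le hz0 hz1 Q) (by positivity)
  rw [hdecomp] at hstep1
  refine (abs_sub_le _ _ _).trans ((add_le_add hstep1 hstep3).trans ?_)
  have hmul : ℓ ^ 2 * (6 * n) * p ^ ℓ * p ^ ℓ ≤ ℓ ^ 2 * (6 * n) * p * p ^ ℓ := by gcongr
  linarith

end

/-! ### From the one-step recursion to an exponential. -/

section

/-- Multiplication by `1 - y ∈ [0, 1]` does not enlarge earlier errors, so they add up only
linearly. -/
theorem abs_recursion_sub_le {u : ℕ → ℝ} {y ε : ℝ} (hy0 : 0 ≤ y) (hy1 : y ≤ 1) {K : ℕ}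
    (h : ∀ k, K ≤ k → |u (k + 1) - (1 - y) * u k| ≤ ε) (m : ℕ) :
    |u (K + m) - (1 - y) ^ m * u K| ≤ m * ε := by
  induction m with
  | zero => simp
  | succ m ih =>
    have h1 := h (K + m) (Nat.le_add_right _ _)
    have h2 : |(1 - y) * u (K + m) - (1 - y) ^ (m + 1) * u K| ≤ m * ε := by
      rw [show (1 - y) * u (K + m) - (1 - y) ^ (m + 1) * u K =
        (1 - y) * (u (K + m) - (1 - y) ^ m * u K) by ring, abs_mul,
        abs_of_nonneg (by linarith : 0 ≤ 1 - y)]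
      exact (mul_le_of_le_one_left (abs_nonneg _) (by linarith)).trans ih
    refine (abs_sub_le _ ((1 - y) * u (K + m)) _).trans ((add_le_add h1 h2).trans_eq ?_)
    push_cast
    ring

/-- The sequence `exp (-k * y)` satisfies the recursion with error `y²` per step. -/
theorem abs_one_sub_pow_sub_exp_le {y : ℝ} (hy0 : 0 ≤ y) (hy1 : y ≤ 1) (m : ℕ) :
    |(1 - y) ^ m - Real.exp (-(m * y))| ≤ m * y ^ 2 := by
  have h := abs_recursion_sub_le (u := fun k => Real.exp (-y) ^ k) (K := 0) hy0 hy1 (ε := y ^ 2)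
    (fun k _ => by
      have h1 := Real.abs_exp_sub_one_sub_id_le (x := -y) (by rw [abs_neg, abs_of_nonneg hy0]; exact hy1)
      have h2 : Real.exp (-y) ^ k ≤ 1 :=
        pow_le_one₀ (Real.exp_pos _).le (Real.exp_le_one_iff.2 (by linarith))
      rw [show Real.exp (-y) ^ (k + 1) - (1 - y) * Real.exp (-y) ^ k =
        Real.exp (-y) ^ k * (Real.exp (-y) - 1 - -y) by ring, abs_mul,
        abs_of_nonneg (pow_nonneg (Real.exp_pos _).le k)]
      calc _ ≤ 1 * (-y) ^ 2 := by gcongr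
        _ = y ^ 2 := by ring) m
  rw [abs_sub_comm]
  simpa [← Real.exp_nat_mul] using h

theorem abs_exp_neg_sub_exp_neg_le {a b : ℝ} (ha : 0 ≤ a) (hb : 0 ≤ b) :
    |Real.exp (-a) - Real.exp (-b)| ≤ |a - b| := by
  wlog hab : a ≤ b generalizing a b
  · rw [abs_sub_comm, abs_sub_comm a]
    exact this hb ha (le_of_not_ge hab)
  have h1 : Real.exp (-b) ≤ Real.exp (-a) := Real.exp_le_exp.2 (by linarith)
  rw [abs_of_nonneg (by linarith), abs_of_nonpos (by linarith)]
  have h2 : Real.exp (-b) = Real.exp (-a) * Real.exp (-(b - a)) := by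
    rw [← Real.exp_add]; congr 1; ring
  have h3 := Real.add_one_le_exp (-(b - a))
  have h4 : Real.exp (-a) ≤ 1 := Real.exp_le_one_iff.2 (by linarith)
  nlinarith [Real.exp_pos (-a)]

theorem tendsto_natCast_mul_pow_div {θ : ℝ} (hθ0 : 0 ≤ θ) (hθ1 : θ < 1) {g : ℕ} (hg : 1 ≤ g) :
    Tendsto (fun n : ℕ => (n : ℝ) * θ ^ (n / g)) atTop (𝓝 0) := by
  have h1 : Tendsto (fun m : ℕ => (g : ℝ) * (m * θ ^ m + θ ^ m)) atTop (𝓝 0) := by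
    have := ((tendsto_self_mul_const_pow_of_lt_one hθ0 hθ1).add
      (tendsto_pow_atTop_nhds_zero_of_lt_one hθ0 hθ1)).const_mul (g : ℝ)
    simpa using this
  have h2 : Tendsto (fun n : ℕ => n / g) atTop atTop := Nat.tendsto_div_const_atTop (by omega)
  refine squeeze_zero (fun n => by positivity) (fun n => ?_) (h1.comp h2)
  have h3 : n ≤ g * (n / g + 1) := by
    have := Nat.lt_mul_div_succ n (by omega : 0 < g)
    omega
  have h4 : (n : ℝ) ≤ g * ((n / g : ℕ) + 1) := by exact_mod_cast h3
  calc (n : ℝ) * θ ^ (n / g) ≤ g * ((n / g : ℕ) + 1) * θ ^ (n / g) := by gcongr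
    _ = _ := by simp only [Function.comp]; ring

variable {𝒜 : Type*} {ℓ : ℕ} [MeasurableSpace 𝒜] {P : Measure (ℕ → 𝒜)}

theorem clumpWeight_div_eq (d : Fin ℓ → ℕ) (ω : ℕ → 𝒜) (q n Q : ℕ) (z : ℝ) :
    clumpWeight P d ω q n Q z / P.real (cyl ω n) ^ ℓ =
      ∑ a ∈ Finset.range (Q + 1), gapCoeff z a *
        ∏ j, (P.real (cyl ω (n + d j * (a * q))) / P.real (cyl ω n)) := by
  rw [clumpWeight, Finset.sum_div]
  refine Finset.sum_congr rfl fun a _ => ?_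
  rw [Finset.prod_div_distrib, Finset.prod_const, Finset.card_univ, Fintype.card_fin, mul_div_assoc]

variable [IsProbabilityMeasure P]

/-- A crude bound valid at every time, for the initial times where block mixing gives nothing. -/
theorem measureReal_multiReturn_le_of_invariant (hinv : MeasurePreserving shift P P)
    (d : Fin ℓ → ℕ) (i : Fin ℓ) {A : Set (ℕ → 𝒜)} (hA : MeasurableSet A) (k : ℕ) :
    P.real (multiReturn d A k) ≤ P.real A := by
  calc P.real (multiReturn d A k) ≤ P.real (shift^[d i * k] ⁻¹' A) :=
        measureReal_mono (Set.iInter_subset _ i)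
    _ = P.real A := by
        rw [Measure.real, (hinv.iterate _).measure_preimage hA.nullMeasurableSet, Measure.real]

theorem integral_pow_hitCount_succ (d : Fin ℓ → ℕ) {A : Set (ℕ → 𝒜)} (hA : MeasurableSet A)
    {K k : ℕ} (hk : K ≤ k) {z : ℝ} (hz0 : 0 ≤ z) (hz1 : z ≤ 1) :
    ∫ x, z ^ hitCount d A (Finset.Ico K (k + 1)) x ∂P =
      ∫ x, z ^ hitCount d A (Finset.Ico K k) x ∂P -
        (1 - z) * ∫ x in multiReturn d A k, z ^ hitCount d A (Finset.Ico K k) x ∂P := by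
  have hint := integrable_pow_of_measurable (P := P)
    (measurable_hitCount hA (Finset.Ico K k) (d := d)) hz0 hz1
  have hm := measurableSet_multiReturn (d := d) hA k
  rw [← integral_indicator hm, ← integral_const_mul,
    ← integral_sub hint ((hint.indicator hm).const_mul _)]
  congr 1
  funext x
  have hsum : hitCount d A (Finset.Ico K (k + 1)) x =
      hitCount d A (Finset.Ico K k) x + (multiReturn d A k).indicator (fun _ => 1) x := by
    rw [hitCount_eq_sum, hitCount_eq_sum, Finset.sum_Ico_succ_top hk]
  rw [hsum, pow_add]
  by_cases hx : x ∈ multiReturn d A k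
  · simp only [Set.indicator_of_mem hx]; ring
  · simp [Set.indicator_of_notMem hx]

theorem prod_div_mem_Icc {ω : ℕ → 𝒜} {n : ℕ} (e : Fin ℓ → ℕ) :
    ∏ j, (P.real (cyl ω (n + e j)) / P.real (cyl ω n)) ∈ Set.Icc (0 : ℝ) 1 :=
  ⟨Finset.prod_nonneg fun _ _ => div_nonneg measureReal_nonneg measureReal_nonneg,
    Finset.prod_le_one (fun _ _ => div_nonneg measureReal_nonneg measureReal_nonneg) fun _ _ =>
      div_le_one_of_le₀ (measureReal_mono (cyl_anti ω (Nat.le_add_right _ _))) measureReal_nonneg⟩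

theorem clumpWeight_div_mem_Icc (d : Fin ℓ → ℕ) {ω : ℕ → 𝒜} {n : ℕ}
    (hω : P.real (cyl ω n) ≠ 0) (q Q : ℕ) {z : ℝ} (hz0 : 0 ≤ z) (hz1 : z ≤ 1) :
    clumpWeight P d ω q n Q z / P.real (cyl ω n) ^ ℓ ∈ Set.Icc (0 : ℝ) 1 := by
  rw [clumpWeight_div_eq]
  exact sum_gapCoeff_mul_mem_Icc hz0 hz1 Q (by simp [hω]) fun a =>
    prod_div_mem_Icc fun j => d j * (a * q)

/-- The recursion runs from `5 * n` to `N + 1`; `t + 1` bounds the number of steps times `p ^ ℓ`,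
and the other terms pay for the initial times, for rounding in `N`, and for replacing a power by an
exponential. -/
theorem abs_integral_pow_returnCount_sub_le [Countable 𝒜] [DiscreteMeasurableSpace 𝒜]
    (hinv : MeasurePreserving shift P P)
    {d : Fin ℓ → ℕ} (hd : ∀ j, 1 ≤ d j)
    (hinj : Function.Injective d) {n : ℕ} (hn : 1 ≤ n) {η : ℝ} (hblock : BlockMixing P ℓ n η)
    (hη0 : 0 ≤ η) (hη : η ≤ 1) (hmix : MixingAt P n 1) {ω : ℕ → 𝒜} {r : ℕ}
    (hper : HasPeriods ω r) (hr : 1 ≤ r) {g : ℕ} {θ : ℝ} (hθ : 0 ≤ θ)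
    (hdecay : ∀ (b c J : ℕ) (E : Set (ℕ → 𝒜)), DeterminedBy (Set.Iio b) E →
      P.real (E ∩ shift^[b] ⁻¹' cyl (shift^[c] ω) (g * J)) ≤ θ ^ J * P.real E)
    {i : Fin ℓ} (hi : ∀ j, d j ≤ d i) {H : ℕ} (hH : d i * H + r ≤ n)
    (hω : 0 < P.real (cyl ω n)) {t : ℝ} (ht : 0 < t) (hN : 5 * n * P.real (cyl ω n) ≤ t)
    {z : ℝ} (hz0 : 0 ≤ z) (hz1 : z ≤ 1) :
    |∫ x, z ^ returnCount d (cyl ω n) (trials P ℓ t ω n) x ∂P -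
      Real.exp (-(t * (1 - z) *
        (clumpWeight P d ω (kappa d r) n (H / kappa d r) z / P.real (cyl ω n) ^ ℓ)))| ≤
      (t + 1) * (ℓ ^ 2 * (6 * n) * (8 * P.real (cyl ω n) + 2 * θ ^ (H / g)) + 2 * η) +
        (14 * n + t + 2) * P.real (cyl ω n) := by
  have hAm : MeasurableSet (cyl ω n) := measurableSet_cyl ω n
  have hC := clumpWeight_div_mem_Icc (P := P) d hω.ne' (kappa d r) (H / kappa d r) hz0 hz1
  have hq : clumpWeight P d ω (kappa d r) n (H / kappa d r) z =
      P.real (cyl ω n) ^ ℓ *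
        (clumpWeight P d ω (kappa d r) n (H / kappa d r) z / P.real (cyl ω n) ^ ℓ) := by
    field_simp
  have hrec : ∀ k, 5 * n ≤ k → _ := fun k hk =>
    abs_setIntegral_multiReturn_sub_le hd hinj hblock hη0 hη hmix hper hr hθ hdecay hi hH hk
      hz0 hz1
  set W := clumpWeight P d ω (kappa d r) n (H / kappa d r) z / P.real (cyl ω n) ^ ℓ
  rw [hq] at hrec
  set p := P.real (cyl ω n) with hp
  set err := (ℓ : ℝ) ^ 2 * (6 * n) * (8 * p + 2 * θ ^ (H / g)) + 2 * η
  have hp0 : 0 ≤ p := measureReal_nonneg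
  have hp1 : p ≤ 1 := measureReal_le_one
  have hpp : p ^ ℓ ≤ p := pow_le_of_le_one hp0 hp1 (by have := i.2; omega)
  have hpℓ : 0 < p ^ ℓ := pow_pos hω _
  have herr : 0 ≤ err := by positivity
  have hret : ∀ k, P.real (multiReturn d (cyl ω n) k) ≤ p := fun k =>
    measureReal_multiReturn_le_of_invariant hinv d i hAm k
  set y := (1 - z) * (p ^ ℓ * W)
  have h1z : 0 ≤ 1 - z := by linarith
  have hy0 : 0 ≤ y := mul_nonneg h1z (mul_nonneg hpℓ.le hC.1)
  have hyp : y ≤ p ^ ℓ := by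
    calc y ≤ 1 * (p ^ ℓ * 1) := by
          apply mul_le_mul (by linarith) (mul_le_mul_of_nonneg_left hC.2 hpℓ.le)
            (mul_nonneg hpℓ.le hC.1) zero_le_one
      _ = p ^ ℓ := by ring
  have hy1 : y ≤ 1 := by linarith
  -- Counting starts at `4 * n`, where distinct blocks of one return are separated enough for the
  -- pair bounds.
  let u : ℕ → ℝ := fun k => ∫ x, z ^ hitCount d (cyl ω n) (Finset.Ico (4 * n) k) x ∂P
  have hu : ∀ k, 5 * n ≤ k → |u (k + 1) - (1 - y) * u k| ≤ err * p ^ ℓ := by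
    intro k hk
    have h1 := integral_pow_hitCount_succ (P := P) d hAm (by omega : 4 * n ≤ k) hz0 hz1
    have h2 := hrec k hk
    simp only [u]
    rw [h1]
    set I := ∫ x in multiReturn d (cyl ω n) k,
      z ^ hitCount d (cyl ω n) (Finset.Ico (4 * n) k) x ∂P
    set v := ∫ x, z ^ hitCount d (cyl ω n) (Finset.Ico (4 * n) k) x ∂P
    rw [show v - (1 - z) * I - (1 - y) * v = -((1 - z) * (I - p ^ ℓ * W * v)) by
      simp only [y]; ring, abs_neg, abs_mul, abs_of_nonneg h1z]
    exact (mul_le_of_le_one_left (abs_nonneg _) (by linarith)).trans h2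
  set N := trials P ℓ t ω n with hNdef
  have hNle : (N : ℝ) * p ^ ℓ ≤ t := by
    have : (N : ℝ) ≤ t * (p ^ ℓ)⁻¹ := Nat.floor_le (by positivity)
    calc (N : ℝ) * p ^ ℓ ≤ t * (p ^ ℓ)⁻¹ * p ^ ℓ := by gcongr
      _ = t := by field_simp
  have hNge : t ≤ (N + 1 : ℝ) * p ^ ℓ := by
    have : t * (p ^ ℓ)⁻¹ ≤ (N : ℝ) + 1 := (Nat.lt_floor_add_one _).le
    calc t = t * (p ^ ℓ)⁻¹ * p ^ ℓ := by field_simp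
      _ ≤ _ := by gcongr
  have h5n : 5 * n ≤ N := by
    refine Nat.le_floor ?_
    rw [← div_eq_mul_inv, le_div_iff₀ hpℓ]
    push_cast
    exact (mul_le_mul_of_nonneg_left hpp (by positivity)).trans hN
  -- The endpoint is `N + 1` because the half-open interval must include time `N`.
  obtain ⟨M, hM⟩ := Nat.exists_eq_add_of_le (show 5 * n ≤ N + 1 by omega)
  have hMr : (M : ℝ) = N + 1 - 5 * n := by
    have : ((N + 1 : ℕ) : ℝ) = ((5 * n + M : ℕ) : ℝ) := by rw [hM]
    push_cast at this
    linarith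
  have hnp : (n : ℝ) * p ^ ℓ ≤ n * p := by gcongr
  have hMt : |(M : ℝ) * p ^ ℓ - t| ≤ (5 * n + 1) * p := by
    rw [hMr, abs_le]
    have : 0 ≤ n * p := by positivity
    have : 0 ≤ n * p ^ ℓ := by positivity
    constructor <;> nlinarith
  have hMp : (M : ℝ) * p ^ ℓ ≤ t + 1 := by
    rw [hMr]
    have : 0 ≤ n * p ^ ℓ := by positivity
    nlinarith
  have hmain := abs_recursion_sub_le hy0 hy1 hu M
  rw [← hM] at hmain
  have hstart : |u (5 * n) - 1| ≤ 5 * n * p := by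
    have := abs_setIntegral_pow_hitCount_union_sub_le (P := P) (d := d) hAm
      (Finset.disjoint_empty_left (Finset.Ico (4 * n) (5 * n))) Set.univ hz0 hz1
    simp only [Finset.empty_union, Measure.restrict_univ, Set.inter_univ] at this
    have h0 : ∫ x, z ^ hitCount d (cyl ω n) ∅ x ∂P = 1 := by simp [hitCount]
    rw [h0] at this
    refine this.trans ((Finset.sum_le_sum fun k _ => hret k).trans ?_)
    rw [Finset.sum_const, nsmul_eq_mul, Nat.card_Ico]
    gcongr
    exact_mod_cast Nat.sub_le _ _
  have hend : |∫ x, z ^ returnCount d (cyl ω n) N x ∂P - u (N + 1)| ≤ 4 * n * p := by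
    have hdisj : Disjoint (Finset.Ico (4 * n) (N + 1)) (Finset.Ico 1 (4 * n)) := by
      rw [Finset.disjoint_left]
      intro x hx hx'
      rw [Finset.mem_Ico] at hx hx'
      omega
    have hunion : Finset.Ico (4 * n) (N + 1) ∪ Finset.Ico 1 (4 * n) = Finset.Icc 1 N := by
      ext x
      simp only [Finset.mem_union, Finset.mem_Ico, Finset.mem_Icc]
      omega
    have := abs_setIntegral_pow_hitCount_union_sub_le (P := P) (d := d) hAm hdisj Set.univ
      hz0 hz1
    simp only [hunion, Measure.restrict_univ, Set.inter_univ] at this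
    rw [returnCount_eq_hitCount]
    refine this.trans ((Finset.sum_le_sum fun k _ => hret k).trans ?_)
    rw [Finset.sum_const, nsmul_eq_mul, Nat.card_Ico]
    gcongr
    exact_mod_cast Nat.sub_le _ _
  have hpow : |(1 - y) ^ M * u (5 * n) - (1 - y) ^ M| ≤ 5 * n * p := by
    rw [← mul_sub_one, abs_mul, abs_of_nonneg (pow_nonneg (by linarith) M)]
    exact (mul_le_of_le_one_left (abs_nonneg _)
      (pow_le_one₀ (by linarith) (by linarith))).trans hstart
  have hexp1 : |(1 - y) ^ M - Real.exp (-(M * y))| ≤ (t + 1) * p := by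
    refine (abs_one_sub_pow_sub_exp_le hy0 hy1 M).trans ?_
    calc (M : ℝ) * y ^ 2 = M * y * y := by ring
      _ ≤ M * p ^ ℓ * p := by
          have := hyp.trans hpp
          gcongr
      _ ≤ (t + 1) * p := by gcongr
  have hexp2 : |Real.exp (-(M * y)) - Real.exp (-(t * (1 - z) * W))| ≤ (5 * n + 1) * p := by
    refine (abs_exp_neg_sub_exp_neg_le (by positivity)
      (mul_nonneg (mul_nonneg ht.le h1z) hC.1)).trans ?_
    rw [show M * y - t * (1 - z) * W = ((1 - z) * W) * (M * p ^ ℓ - t) by simp only [y]; ring,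
      abs_mul, abs_of_nonneg (mul_nonneg h1z hC.1)]
    exact (mul_le_of_le_one_left (abs_nonneg _)
      (mul_le_one₀ (by linarith) hC.1 hC.2)).trans hMt
  have hmain' : |u (N + 1) - (1 - y) ^ M * u (5 * n)| ≤ (t + 1) * err := by
    refine hmain.trans ?_
    calc (M : ℝ) * (err * p ^ ℓ) = M * p ^ ℓ * err := by ring
      _ ≤ _ := by gcongr
  rw [abs_le] at hend hmain' hpow hexp1 hexp2 ⊢
  constructor <;> linarith [hend.1, hend.2, hmain'.1, hmain'.2, hpow.1, hpow.2, hexp1.1, hexp1.2,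
    hexp2.1, hexp2.2]

end

/-! ### Weak convergence on `ℕ` from generating functions. -/

section

section generatingFunctionConvergence

theorem abs_integral_pow_sub_sum_le (μ : ProbabilityMeasure ℕ) {z : ℝ} (hz0 : 0 ≤ z)
    (hz1 : z ≤ 1) (m : ℕ) :
    |∫ k, z ^ k ∂(μ : Measure ℕ) -
      ∑ i ∈ Finset.range m, (μ : Measure ℕ).real {i} * z ^ i| ≤ z ^ m := by
  have hint : Integrable (fun k : ℕ => z ^ k) (μ : Measure ℕ) :=
    integrable_pow_of_measurable measurable_id hz0 hz1
  have hind : ∀ i ∈ Finset.range m,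
      Integrable (({i} : Set ℕ).indicator fun _ => z ^ i) (μ : Measure ℕ) := fun i _ =>
    (integrable_const _).indicator (measurableSet_singleton i)
  have hsum : ∑ i ∈ Finset.range m, (μ : Measure ℕ).real {i} * z ^ i =
      ∫ k, ∑ i ∈ Finset.range m, ({i} : Set ℕ).indicator (fun _ => z ^ i) k ∂(μ : Measure ℕ) := by
    rw [integral_finsetSum _ hind]
    refine Finset.sum_congr rfl fun i _ => ?_
    rw [integral_indicator (measurableSet_singleton i), setIntegral_const, smul_eq_mul]
  rw [hsum, ← integral_sub hint (integrable_finsetSum _ hind)]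
  refine abs_integral_le_integral_abs.trans ?_
  calc _ ≤ ∫ _, z ^ m ∂(μ : Measure ℕ) := by
        refine integral_mono (hint.sub (integrable_finsetSum _ hind)).abs (integrable_const _)
          fun k => ?_
        have hpt : ∑ i ∈ Finset.range m, ({i} : Set ℕ).indicator (fun _ => z ^ i) k =
            if k < m then z ^ k else 0 := by
          split_ifs with hk
          · rw [Finset.sum_eq_single k]
            · simp
            · exact fun i _ hi => Set.indicator_of_notMem (fun h => hi (Eq.symm h)) _
            · exact fun h => absurd (Finset.mem_range.2 hk) h
          · refine Finset.sum_eq_zero fun i hi => Set.indicator_of_notMem (fun h => hk ?_) _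
            rw [Set.mem_singleton_iff.1 h]
            exact Finset.mem_range.1 hi
        simp only [hpt]
        split_ifs with hk
        · simpa using pow_nonneg hz0 m
        · rw [sub_zero, abs_of_nonneg (pow_nonneg hz0 k)]
          exact pow_le_pow_of_le_one hz0 hz1 (not_lt.1 hk)
    _ = z ^ m := by simp

/-- By strong induction the terms below `m` already converge and can be subtracted. Division by `z ^
m` isolates the mass at `m`, up to a tail of size at most `z`. -/
theorem tendsto_real_singleton_of_tendsto_integral_pow {μs : ℕ → ProbabilityMeasure ℕ}
    {μ : ProbabilityMeasure ℕ}
    (h : ∀ z : ℝ, 0 < z → z < 1 → Tendsto (fun n => ∫ k, z ^ k ∂(μs n : Measure ℕ)) atTop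
      (𝓝 (∫ k, z ^ k ∂(μ : Measure ℕ)))) (m : ℕ) :
    Tendsto (fun n => (μs n : Measure ℕ).real {m}) atTop (𝓝 ((μ : Measure ℕ).real {m})) := by
  induction m using Nat.strong_induction_on with
  | _ m ih =>
  rw [Metric.tendsto_atTop']
  intro ε hε
  -- Two tails, each at most `ε / 4`, and a convergence error below `ε / 2`, all relative to `z ^
  -- m`.
  obtain ⟨z, hz0, hz⟩ := exists_between (show 0 < min 1 (ε / 4) by positivity)
  have hz1 : z < 1 := hz.trans_le (min_le_left _ _)
  have hzε : z < ε / 4 := hz.trans_le (min_le_right _ _)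
  have hlim : Tendsto (fun n => (∫ k, z ^ k ∂(μs n : Measure ℕ) -
      ∑ i ∈ Finset.range m, (μs n : Measure ℕ).real {i} * z ^ i) -
      (∫ k, z ^ k ∂(μ : Measure ℕ) - ∑ i ∈ Finset.range m, (μ : Measure ℕ).real {i} * z ^ i))
      atTop (𝓝 0) := by
    have h1 := (h z hz0 hz1).sub (tendsto_finsetSum (Finset.range m) fun i hi =>
      (ih i (Finset.mem_range.1 hi)).mul_const (z ^ i))
    have h2 := h1.sub_const (∫ k, z ^ k ∂(μ : Measure ℕ) -
      ∑ i ∈ Finset.range m, (μ : Measure ℕ).real {i} * z ^ i)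
    rwa [sub_self] at h2
  have hzm : 0 < z ^ m := pow_pos hz0 m
  obtain ⟨N, hN⟩ := (Metric.tendsto_atTop.1 hlim) (ε / 2 * z ^ m) (by positivity)
  refine ⟨N, fun n hn => ?_⟩
  have h0 := hN n hn.le
  have h1 := abs_integral_pow_sub_sum_le (μs n) hz0.le hz1.le (m + 1)
  have h2 := abs_integral_pow_sub_sum_le μ hz0.le hz1.le (m + 1)
  rw [Finset.sum_range_succ] at h1 h2
  rw [Real.dist_eq, sub_zero] at h0
  rw [Real.dist_eq]
  set a := (μs n : Measure ℕ).real {m}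
  set b := (μ : Measure ℕ).real {m}
  have h3 : |(a - b) * z ^ m| < ε * z ^ m := by
    have h4 : z ^ (m + 1) ≤ ε / 4 * z ^ m := by
      rw [pow_succ, mul_comm]; gcongr
    rw [sub_mul]
    rw [abs_le] at h1 h2
    rw [abs_lt] at h0 ⊢
    constructor <;> linarith [h0.1, h0.2, h1.1, h1.2, h2.1, h2.2]
  rw [abs_mul, abs_of_pos hzm] at h3
  exact lt_of_mul_lt_mul_right h3 hzm.le

/-- Portmanteau for open sets: the limit mass of `G` is nearly attained on a finite subset, where
convergence of point masses suffices. No mass escapes because the limit is itself a probability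
measure. -/
theorem tendsto_of_tendsto_real_singleton {μs : ℕ → ProbabilityMeasure ℕ}
    {μ : ProbabilityMeasure ℕ}
    (h : ∀ m : ℕ, Tendsto (fun n => (μs n : Measure ℕ).real {m}) atTop
      (𝓝 ((μ : Measure ℕ).real {m}))) : Tendsto μs atTop (𝓝 μ) := by
  refine tendsto_of_forall_isOpen_le_liminf fun G _ => ?_
  have hfin : ∀ F : Finset ℕ, Tendsto (fun n => (μs n) (F : Set ℕ)) atTop (𝓝 (μ (F : Set ℕ))) := by
    intro F
    rw [← NNReal.tendsto_coe]
    have hF : ∀ ν : ProbabilityMeasure ℕ, ((ν (F : Set ℕ) : NNReal) : ℝ) =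
        ∑ i ∈ F, (ν : Measure ℕ).real {i} := fun ν =>
      (sum_measureReal_singleton F).symm
    simp only [hF]
    exact tendsto_finsetSum _ fun i _ => h i
  have happrox : Tendsto (fun m : ℕ => μ (G ∩ Set.Iio m)) atTop (𝓝 (μ G)) := by
    have h1 : Tendsto (fun m : ℕ => (μ : Measure ℕ) (G ∩ Set.Iio m)) atTop
        (𝓝 ((μ : Measure ℕ) (⋃ m : ℕ, G ∩ Set.Iio m))) :=
      tendsto_measure_iUnion_atTop fun m n hmn =>
        Set.inter_subset_inter_right _ (Set.Iio_subset_Iio hmn)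
    rw [← Set.inter_iUnion, Set.iUnion_Iio, Set.inter_univ] at h1
    exact (ENNReal.tendsto_toNNReal (measure_ne_top _ _)).comp h1
  refine le_of_forall_lt fun c hc => ?_
  obtain ⟨c', hc, hc'⟩ := exists_between hc
  obtain ⟨m, hm⟩ := (happrox.eventually (lt_mem_nhds hc')).exists
  have hfinite : (G ∩ Set.Iio m).Finite := (Set.finite_Iio m).inter_of_right G
  have hev := (hfin hfinite.toFinset).eventually (lt_mem_nhds (by simpa using hm))
  refine hc.trans_le (le_liminf_of_le ?_ ?_)
  · exact IsBoundedUnder.isCoboundedUnder_ge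
      ⟨1, eventually_map.2 (Eventually.of_forall fun n => (μs n).apply_le_one G)⟩
  · filter_upwards [hev] with n hn
    exact hn.le.trans ((μs n).apply_mono (by simp))

end generatingFunctionConvergence

/-! ### The Pólya–Aeppli generating function. -/

section polyaAeppli

theorem polyaAeppliMass_succ_mul_pow (s p z : ℝ) (k : ℕ) :
    polyaAeppliMass s p (k + 1) * z ^ (k + 1) = ∑ x ∈ Finset.HasAntidiagonal.antidiagonal k,
      Real.exp (-s) * (s ^ (x.1 + 1) / (x.1 + 1).factorial * (1 - p) ^ (x.1 + 1) * z ^ (x.1 + 1)) *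
        (((x.2 + x.1).choose x.1 : ℝ) * (p * z) ^ x.2) := by
  rw [Finset.Nat.sum_antidiagonal_eq_sum_range_succ_mk, polyaAeppliMass,
    if_neg (Nat.succ_ne_zero k), ← Finset.Ico_add_one_right_eq_Icc, Finset.sum_Ico_eq_sum_range,
    mul_assoc, Finset.sum_mul, Finset.mul_sum]
  refine Finset.sum_congr (by simp) fun j hj => ?_
  have hjk : j ≤ k := by
    have := Finset.mem_range.1 hj
    omega
  simp only
  rw [Nat.sub_add_cancel hjk, show k + 1 - 1 = k by omega, show 1 + j - 1 = j by omega,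
    show k + 1 - (1 + j) = k - j by omega, show k + 1 = (j + 1) + (k - j) by omega, pow_add,
    mul_pow, add_comm 1 j]
  ring

theorem hasSum_sum_antidiagonal {f : ℕ × ℕ → ℝ} {a : ℝ} (hf : HasSum f a) :
    HasSum (fun k => ∑ x ∈ Finset.HasAntidiagonal.antidiagonal k, f x) a := by
  have h := (Finset.HasAntidiagonal.sigmaAntidiagonalEquivProd (A := ℕ)).hasSum_iff.2 hf
  have h2 := h.sigma fun k => hasSum_fintype _
  have hk : (fun k => ∑ x ∈ Finset.HasAntidiagonal.antidiagonal k, f x) =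
      fun k => ∑ x : Finset.HasAntidiagonal.antidiagonal k, f x :=
    funext fun k => (Finset.sum_coe_sort _ f).symm
  rw [hk]
  exact h2

theorem hasSum_pow_succ_div_factorial (w : ℝ) :
    HasSum (fun j : ℕ => w ^ (j + 1) / (j + 1).factorial) (Real.exp w - 1) := by
  have h := NormedSpace.expSeries_div_hasSum_exp (𝔸 := ℝ) w
  rw [← Real.exp_eq_exp_ℝ] at h
  have := (hasSum_nat_add_iff' 1).2 h
  simpa using this

/-- The positive-index part is the diagonal rearrangement of a nonnegative double series. Its rows
are negative binomial series summing to powers of `1 / (1 - p z)`, and the row sums form an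
exponential series. -/
theorem hasSum_polyaAeppliMass_mul_pow {s p z : ℝ} (hs : 0 ≤ s) (hp0 : 0 ≤ p) (hp1 : p < 1)
    (hz0 : 0 ≤ z) (hz1 : z ≤ 1) :
    HasSum (fun k => polyaAeppliMass s p k * z ^ k) (Real.exp (-(s * (1 - z) / (1 - p * z)))) := by
  have hpz1 : p * z < 1 := by nlinarith
  have hpz0 : 0 ≤ p * z := mul_nonneg hp0 hz0
  have h1p : 0 ≤ 1 - p := by linarith
  -- Since `w - s = -s (1 - z) / (1 - p z)`, this is the exponent that produces the stated value.
  set w := s * (1 - p) * z / (1 - p * z) with hw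
  let f : ℕ × ℕ → ℝ := fun x =>
    Real.exp (-s) * (s ^ (x.1 + 1) / (x.1 + 1).factorial * (1 - p) ^ (x.1 + 1) * z ^ (x.1 + 1)) *
      (((x.2 + x.1).choose x.1 : ℝ) * (p * z) ^ x.2)
  have hf0 : 0 ≤ f := fun x => by simp only [f, Pi.zero_apply]; positivity
  have hrow : ∀ j, HasSum (fun i => f (j, i))
      (Real.exp (-s) * (w ^ (j + 1) / (j + 1).factorial)) := by
    intro j
    have h := (hasSum_choose_mul_geometric_of_norm_lt_one (𝕜 := ℝ) j (r := p * z)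
      (by rwa [Real.norm_of_nonneg hpz0])).mul_left
      (Real.exp (-s) * (s ^ (j + 1) / (j + 1).factorial * (1 - p) ^ (j + 1) * z ^ (j + 1)))
    have hval : Real.exp (-s) * (w ^ (j + 1) / (j + 1).factorial) = Real.exp (-s) *
        (s ^ (j + 1) / (j + 1).factorial * (1 - p) ^ (j + 1) * z ^ (j + 1)) *
          (1 / (1 - p * z) ^ (j + 1)) := by
      rw [hw, div_pow, mul_pow, mul_pow]
      ring
    rw [hval]
    exact h
  have hcol : HasSum (fun j : ℕ => Real.exp (-s) * (w ^ (j + 1) / (j + 1).factorial))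
      (Real.exp (-s) * (Real.exp w - 1)) := (hasSum_pow_succ_div_factorial w).mul_left _
  have hsummable : Summable f := by
    refine (summable_prod_of_nonneg hf0).2 ⟨fun j => (hrow j).summable, ?_⟩
    simpa only [(hrow _).tsum_eq] using hcol.summable
  have hf : HasSum f (Real.exp (-s) * (Real.exp w - 1)) := by
    have h := hsummable.hasSum
    have hval := (h.prod_fiberwise hrow).unique hcol
    rw [← hval]
    exact h
  have hdiag : HasSum (fun k => polyaAeppliMass s p (k + 1) * z ^ (k + 1))
      (Real.exp (-s) * (Real.exp w - 1)) := by
    simpa only [polyaAeppliMass_succ_mul_pow] using hasSum_sum_antidiagonal hf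
  have h := (hasSum_nat_add_iff (f := fun k => polyaAeppliMass s p k * z ^ k) 1).1 hdiag
  have hpz : 1 - p * z ≠ 0 := (sub_pos.2 hpz1).ne'
  have hval : Real.exp (-(s * (1 - z) / (1 - p * z))) = Real.exp (-s) * (Real.exp w - 1) +
      ∑ k ∈ Finset.range 1, polyaAeppliMass s p k * z ^ k := by
    rw [Finset.sum_range_one, polyaAeppliMass, if_pos rfl, pow_zero, mul_one, mul_sub_one,
      sub_add_cancel, ← Real.exp_add]
    congr 1
    rw [hw, show s * (1 - z) = s * (1 - p * z) - s * (1 - p) * z by ring, sub_div,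
      mul_div_cancel_right₀ _ hpz]
    ring
  rw [hval]
  exact h

theorem polyaAeppliMass_nonneg {s p : ℝ} (hs : 0 ≤ s) (hp0 : 0 ≤ p) (hp1 : p < 1) (k : ℕ) :
    0 ≤ polyaAeppliMass s p k := by
  have h1p : 0 ≤ 1 - p := by linarith
  unfold polyaAeppliMass
  split_ifs
  · positivity
  · exact mul_nonneg (Real.exp_pos _).le (Finset.sum_nonneg fun j _ => by positivity)

theorem lintegral_pow_polyaAeppli {s p z : ℝ} (hs : 0 ≤ s) (hp0 : 0 ≤ p) (hp1 : p < 1)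
    (hz0 : 0 ≤ z) (hz1 : z ≤ 1) :
    ∫⁻ k, ENNReal.ofReal (z ^ k) ∂(polyaAeppli s p) =
      ENNReal.ofReal (Real.exp (-(s * (1 - z) / (1 - p * z)))) := by
  have h := hasSum_polyaAeppliMass_mul_pow hs hp0 hp1 hz0 hz1
  have h0 := polyaAeppliMass_nonneg hs hp0 hp1
  rw [polyaAeppli, lintegral_sum_measure, ← h.tsum_eq,
    ENNReal.ofReal_tsum_of_nonneg (fun k => mul_nonneg (h0 k) (pow_nonneg hz0 k)) h.summable]
  refine tsum_congr fun k => ?_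
  rw [lintegral_smul_measure, lintegral_dirac, smul_eq_mul, ENNReal.ofReal_mul (h0 k)]

theorem isProbabilityMeasure_polyaAeppli {s p : ℝ} (hs : 0 ≤ s) (hp0 : 0 ≤ p) (hp1 : p < 1) :
    IsProbabilityMeasure (polyaAeppli s p) := by
  have h := lintegral_pow_polyaAeppli hs hp0 hp1 zero_le_one le_rfl
  simp only [one_pow, ENNReal.ofReal_one, sub_self, mul_zero, zero_div, neg_zero, Real.exp_zero,
    lintegral_const, one_mul] at h
  exact ⟨h⟩

theorem integral_pow_polyaAeppli {s p z : ℝ} (hs : 0 ≤ s) (hp0 : 0 ≤ p) (hp1 : p < 1)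
    (hz0 : 0 ≤ z) (hz1 : z ≤ 1) :
    ∫ k, z ^ k ∂(polyaAeppli s p) = Real.exp (-(s * (1 - z) / (1 - p * z))) := by
  rw [integral_eq_lintegral_of_nonneg_ae (ae_of_all _ fun k => pow_nonneg hz0 k)
    measurable_from_top.aestronglyMeasurable, lintegral_pow_polyaAeppli hs hp0 hp1 hz0 hz1,
    ENNReal.toReal_ofReal (Real.exp_pos _).le]

end polyaAeppli

end

/-! ### Limits as the cylinder length grows. -/

section

variable {𝒜 : Type*} {ℓ : ℕ}

/-- A shift by `j < r` of a word of length at least `2 * r` leaves an overlap of at least `r`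
letters, which would force `r ∣ j`. -/
theorem HasPeriods.cylPeriod_eq {ω : ℕ → 𝒜} {r : ℕ} (h : HasPeriods ω r) (hr : 1 ≤ r) {n : ℕ}
    (hn : 2 * r ≤ n) : cylPeriod ω n = r := by
  have hmem : r ∈ {j | 1 ≤ j ∧ j ≤ n ∧ (cyl ω n ∩ (shift^[j]) ⁻¹' cyl ω n).Nonempty} := by
    refine ⟨hr, by omega, ω, fun i _ => rfl, fun i _ => ?_⟩
    rw [shift_iterate_apply]
    exact h.1 r dvd_rfl i
  refine le_antisymm (Nat.sInf_le hmem) (le_csInf ⟨r, hmem⟩ ?_)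
  rintro j ⟨hj1, -, x, hx, hx'⟩
  by_contra hjr
  push Not at hjr
  have hdvd : r ∣ j := h.dvd_of_overlap hr (by omega) fun i hi =>
    (hx (j + i) hi).symm.trans ((shift_iterate_apply j x i).symm.trans (hx' i (by omega)))
  exact absurd (Nat.le_of_dvd hj1 hdvd) (by omega)

theorem HasPeriods.repeatCyl_eq {ω : ℕ → 𝒜} {r : ℕ} (h : HasPeriods ω r) (m : ℕ) :
    repeatCyl ω r m = cyl ω m := by
  rw [repeatCyl, funext h.apply_mod]

theorem returnExponent_eq_sum (d : Fin ℓ → ℕ) {r : ℕ} (hr : 1 ≤ r) :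
    returnExponent d r = ∑ j, d j * kappa d r / r := by
  refine Nat.eq_of_mul_eq_mul_left hr ?_
  rw [mul_returnExponent, Finset.mul_sum, Finset.mul_sum]
  refine Finset.sum_congr rfl fun j _ => ?_
  rw [Nat.mul_div_cancel' (dvd_mul_kappa d r j), mul_comm]

theorem returnExponent_pos {d : Fin ℓ → ℕ} (hd : ∀ j, 1 ≤ d j) (i : Fin ℓ) {r : ℕ} (hr : 1 ≤ r) :
    returnExponent d r ≠ 0 := by
  intro h
  have h1 := mul_returnExponent d r
  rw [h, mul_zero] at h1
  have h2 : 1 ≤ ∑ j, d j := (hd i).trans (Finset.single_le_sum (fun _ _ => Nat.zero_le _)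
    (Finset.mem_univ i))
  have := Nat.mul_le_mul (kappa_pos d hr) h2
  omega

theorem hasSum_gapCoeff_mul_pow {z ρ : ℝ} (hz0 : 0 ≤ z) (hz1 : z < 1) (hρ0 : 0 ≤ ρ)
    (hρ1 : ρ ≤ 1) : HasSum (fun a => gapCoeff z a * ρ ^ a) ((1 - ρ) / (1 - ρ * z)) := by
  have hlt : ρ * z < 1 := by nlinarith
  have h1 := (hasSum_geometric_of_lt_one (mul_nonneg hρ0 hz0) hlt).mul_left ((z - 1) * ρ)
  have h2 : HasSum (fun a => gapCoeff z (a + 1) * ρ ^ (a + 1)) ((z - 1) * ρ * (1 - ρ * z)⁻¹) := by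
    have hfun : (fun a => gapCoeff z (a + 1) * ρ ^ (a + 1)) =
        fun a => (z - 1) * ρ * (ρ * z) ^ a := by
      funext a
      rw [gapCoeff_succ, mul_pow]
      ring
    rw [hfun]
    exact h1
  have h3 := (hasSum_nat_add_iff (f := fun a => gapCoeff z a * ρ ^ a) 1).1 h2
  have hval : (1 - ρ) / (1 - ρ * z) =
      (z - 1) * ρ * (1 - ρ * z)⁻¹ + ∑ a ∈ Finset.range 1, gapCoeff z a * ρ ^ a := by
    have hne : 1 - ρ * z ≠ 0 := (sub_pos.2 hlt).ne'
    rw [Finset.sum_range_one, gapCoeff_zero, pow_zero, one_mul, ← div_eq_mul_inv,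
      div_add_one hne]
    congr 1
    ring
  rw [hval]
  exact h3

/-- Dominated convergence: for `z < 1` the coefficients are absolutely summable and the weights lie
in `[0, 1]`. -/
theorem tendsto_sum_gapCoeff_mul {z ρ : ℝ} (hz0 : 0 ≤ z) (hz1 : z < 1) (hρ0 : 0 ≤ ρ)
    (hρ1 : ρ ≤ 1) {Q : ℕ → ℕ} (hQ : Tendsto Q atTop atTop) {R : ℕ → ℕ → ℝ}
    (hR : ∀ n a, R n a ∈ Set.Icc (0 : ℝ) 1)
    (hlim : ∀ a, Tendsto (fun n => R n a) atTop (𝓝 (ρ ^ a))) :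
    Tendsto (fun n => ∑ a ∈ Finset.range (Q n + 1), gapCoeff z a * R n a) atTop
      (𝓝 ((1 - ρ) / (1 - ρ * z))) := by
  rw [← (hasSum_gapCoeff_mul_pow hz0 hz1 hρ0 hρ1).tsum_eq]
  have hsum : ∀ n, ∑ a ∈ Finset.range (Q n + 1), gapCoeff z a * R n a =
      ∑' a, if a ∈ Finset.range (Q n + 1) then gapCoeff z a * R n a else 0 := by
    intro n
    rw [tsum_eq_sum (s := Finset.range (Q n + 1)) fun a ha => if_neg ha]
    exact Finset.sum_congr rfl fun a ha => (if_pos ha).symm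
  simp only [hsum]
  refine tendsto_tsum_of_dominated_convergence (bound := fun a => |gapCoeff z a|) ?_ ?_ ?_
  · refine (summable_nat_add_iff 1).1 ((summable_geometric_of_lt_one hz0 hz1).of_nonneg_of_le
      (fun a => abs_nonneg _) fun a => ?_)
    rw [abs_of_nonpos (gapCoeff_succ_nonpos hz0 hz1.le a), gapCoeff_succ]
    linarith [pow_nonneg hz0 (a + 1)]
  · intro a
    refine ((hlim a).const_mul _).congr' ?_
    filter_upwards [hQ.eventually_ge_atTop a] with n hn
    rw [if_pos (Finset.mem_range.2 (Nat.lt_succ_of_le hn))]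
  · refine Eventually.of_forall fun n a => ?_
    rw [Real.norm_eq_abs]
    split_ifs
    · rw [abs_mul, abs_of_nonneg (hR n a).1]
      exact mul_le_of_le_one_right (abs_nonneg _) (hR n a).2
    · simp

/-- With `0 ^ 0 = 1` the coefficients at `z = 0` are `1, -1, 0, 0, …`, so only runs of one and two
returns survive. -/
theorem sum_gapCoeff_zero_mul {Q : ℕ} (hQ : 1 ≤ Q) (R : ℕ → ℝ) :
    ∑ a ∈ Finset.range (Q + 1), gapCoeff 0 a * R a = R 0 - R 1 := by
  obtain ⟨Q, rfl⟩ := Nat.exists_eq_add_of_le' hQ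
  rw [Finset.sum_range_succ', Finset.sum_range_succ', Finset.sum_eq_zero]
  · simp [gapCoeff]
    ring
  · intro a _
    simp [gapCoeff]

variable [MeasurableSpace 𝒜] {P : Measure (ℕ → 𝒜)}

theorem cond_real_cyl [DiscreteMeasurableSpace 𝒜] (ω : ℕ → 𝒜) (n m : ℕ) :
    (ProbabilityTheory.cond P (cyl ω n)).real (cyl ω (n + m)) =
      P.real (cyl ω (n + m)) / P.real (cyl ω n) := by
  rw [Measure.real, ProbabilityTheory.cond_apply (measurableSet_cyl ω n),
    Set.inter_eq_right.2 (cyl_anti ω (Nat.le_add_right n m)), ENNReal.toReal_mul,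
    ENNReal.toReal_inv, ← Measure.real, ← Measure.real, div_eq_inv_mul]

theorem rho_eq [DiscreteMeasurableSpace 𝒜] {ω : ℕ → 𝒜} {r : ℕ} (h : HasPeriods ω r) (hr : 1 ≤ r)
    (d : Fin ℓ → ℕ) {n : ℕ} (hn : 2 * r ≤ n) :
    rho P d ω n = ∏ j, (P.real (cyl ω (n + d j * kappa d r)) / P.real (cyl ω n)) := by
  rw [rho, h.cylPeriod_eq hr hn]
  exact Finset.prod_congr rfl fun j _ => by rw [h.repeatCyl_eq, cond_real_cyl]

theorem tendsto_cyl_ratio [DiscreteMeasurableSpace 𝒜] {ω : ℕ → 𝒜}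
    (hω : ∀ n, P.real (cyl ω n) ≠ 0) {r : ℕ} {β : ℝ}
    (hβ : Tendsto (fun n => beta P r ω n) atTop (𝓝 β)) (m : ℕ) :
    Tendsto (fun n => P.real (cyl ω (n + r * m)) / P.real (cyl ω n)) atTop (𝓝 (β ^ m)) := by
  induction m with
  | zero => simp [hω]
  | succ m ih =>
    have h1 := ih.mul (hβ.comp (tendsto_add_atTop_nat (r * m)))
    rw [pow_succ]
    refine h1.congr fun n => ?_
    simp only [Function.comp, beta, cond_real_cyl]
    rw [div_mul_div_comm, mul_comm (P.real (cyl ω (n + r * m))),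
      mul_div_mul_right _ _ (hω _), mul_add_one, ← add_assoc]

variable [IsProbabilityMeasure P]

/-- A periodic point uses finitely many letters, so the bounds below `1` are uniform even over an
infinite alphabet. -/
theorem exists_letter_bound [DiscreteMeasurableSpace 𝒜] (hnondeg : ∀ a : 𝒜, P {x | x 0 = a} < 1)
    {ω : ℕ → 𝒜} {r : ℕ} (h : HasPeriods ω r) (hr : 1 ≤ r) :
    ∃ q : ℝ, q < 1 ∧ ∀ i, P.real {x | x 0 = ω i} ≤ q := by
  have hne : (Finset.range r).Nonempty := Finset.nonempty_range_iff.2 (by omega)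
  refine ⟨(Finset.range r).sup' hne fun i => P.real {x | x 0 = ω i},
    (Finset.sup'_lt_iff hne).2 fun i _ => ?_, fun i => ?_⟩
  · rw [Measure.real, ← ENNReal.toReal_one]
    exact (ENNReal.toReal_lt_toReal (measure_ne_top _ _) ENNReal.one_ne_top).2 (hnondeg _)
  · rw [← h.apply_mod i]
    exact Finset.le_sup' (fun i => P.real {x | x 0 = ω i}) (Finset.mem_range.2 (Nat.mod_lt i hr))

/-- With the gap taken to be `n` and `H = n / (2 * d i)`, the errors `n * p` and `n * θ ^ (H / g)`
vanish by exponential decay, while `η` is fixed in advance and then reached for large `n`. -/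
theorem tendsto_integral_pow_returnCount_sub [Countable 𝒜] [DiscreteMeasurableSpace 𝒜]
    (hinv : MeasurePreserving shift P P) (hmix : PsiMixing P)
    {d : Fin ℓ → ℕ} (hd : ∀ j, 1 ≤ d j) (hinj : Function.Injective d)
    {ω : ℕ → 𝒜} {r : ℕ} (hper : HasPeriods ω r) (hr : 1 ≤ r) {g : ℕ} (hg : 1 ≤ g) {θ : ℝ}
    (hθ : 0 ≤ θ) (hθ1 : θ < 1)
    (hdecay : ∀ (b c J : ℕ) (E : Set (ℕ → 𝒜)), DeterminedBy (Set.Iio b) E →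
      P.real (E ∩ shift^[b] ⁻¹' cyl (shift^[c] ω) (g * J)) ≤ θ ^ J * P.real E)
    {i : Fin ℓ} (hi : ∀ j, d j ≤ d i) (hω : ∀ n, 0 < P.real (cyl ω n)) {t : ℝ} (ht : 0 < t)
    {z : ℝ} (hz0 : 0 ≤ z) (hz1 : z ≤ 1) :
    Tendsto (fun n => ∫ x, z ^ returnCount d (cyl ω n) (trials P ℓ t ω n) x ∂P -
      Real.exp (-(t * (1 - z) * ∑ a ∈ Finset.range (n / (2 * d i) / kappa d r + 1), gapCoeff z a *
        ∏ j, (P.real (cyl ω (n + d j * (a * kappa d r))) / P.real (cyl ω n))))) atTop (𝓝 0) := by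
  have hp : ∀ n, P.real (cyl ω n) ≤ θ ^ (n / g) := by
    intro n
    have h := hdecay 0 0 (n / g) Set.univ (determinedBy_univ _)
    simp only [Function.iterate_zero, id, Set.preimage_id, Set.univ_inter, probReal_univ,
      mul_one] at h
    exact (measureReal_mono (cyl_anti ω (Nat.mul_div_le n g))).trans h
  have hnp : Tendsto (fun n : ℕ => (n : ℝ) * P.real (cyl ω n)) atTop (𝓝 0) :=
    squeeze_zero (fun n => mul_nonneg n.cast_nonneg measureReal_nonneg)
      (fun n => mul_le_mul_of_nonneg_left (hp n) n.cast_nonneg)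
      (tendsto_natCast_mul_pow_div hθ hθ1 hg)
  have hp0 : Tendsto (fun n : ℕ => P.real (cyl ω n)) atTop (𝓝 0) := by
    refine squeeze_zero' (Eventually.of_forall fun n => measureReal_nonneg) ?_ hnp
    filter_upwards [eventually_ge_atTop 1] with n hn
    exact le_mul_of_one_le_left measureReal_nonneg (by exact_mod_cast hn)
  have hdg : 1 ≤ 2 * d i * g := Nat.mul_pos (by have := hd i; omega) hg
  have hnθ := tendsto_natCast_mul_pow_div hθ hθ1 hdg
  have herr : Tendsto (fun n : ℕ => (t + 1) * (ℓ ^ 2 * (6 * n) * (8 * P.real (cyl ω n) +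
      2 * θ ^ (n / (2 * d i) / g))) + (14 * n + t + 2) * P.real (cyl ω n)) atTop (𝓝 0) := by
    have h1 : Tendsto (fun n : ℕ => (t + 1) * (ℓ : ℝ) ^ 2 * 48 * (n * P.real (cyl ω n)) +
        (t + 1) * (ℓ : ℝ) ^ 2 * 12 * (n * θ ^ (n / (2 * d i * g))) +
        14 * (n * P.real (cyl ω n)) + (t + 2) * P.real (cyl ω n)) atTop (𝓝 0) := by
      have := (((hnp.const_mul ((t + 1) * (ℓ : ℝ) ^ 2 * 48)).add
        (hnθ.const_mul ((t + 1) * (ℓ : ℝ) ^ 2 * 12))).add (hnp.const_mul 14)).add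
        (hp0.const_mul (t + 2))
      simpa using this
    refine h1.congr fun n => ?_
    rw [Nat.div_div_eq_div_mul]
    ring
  rw [Metric.tendsto_atTop']
  intro ε hε
  set η := min 1 (ε / (4 * (t + 1)))
  have hη0 : 0 < η := by positivity
  have hηε : (t + 1) * (2 * η) ≤ ε / 2 := by
    have : η ≤ ε / (4 * (t + 1)) := min_le_right _ _
    rw [le_div_iff₀ (by positivity)] at this
    linarith
  have hNlim : Tendsto (fun n : ℕ => 5 * n * P.real (cyl ω n)) atTop (𝓝 0) := by
    have := hnp.const_mul 5
    simpa [mul_assoc] using this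
  have hev : ∀ᶠ n : ℕ in atTop, dist (∫ x, z ^ returnCount d (cyl ω n) (trials P ℓ t ω n) x ∂P -
      Real.exp (-(t * (1 - z) * ∑ a ∈ Finset.range (n / (2 * d i) / kappa d r + 1), gapCoeff z a *
        ∏ j, (P.real (cyl ω (n + d j * (a * kappa d r))) / P.real (cyl ω n))))) 0 < ε := by
    filter_upwards [hmix.eventually_blockMixing ℓ hη0, hmix.eventually_mixingAt zero_lt_one,
      eventually_ge_atTop 1, eventually_ge_atTop (2 * r), hNlim.eventually (gt_mem_nhds ht),
      herr.eventually (gt_mem_nhds (half_pos hε))] with n hb hm hn1 hnr hN herrn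
    -- The near window uses at most half of the word; the other half leaves room for an overlap of
    -- `r`, as `2 * r ≤ n`.
    have hH : d i * (n / (2 * d i)) + r ≤ n := by
      have := Nat.mul_div_le n (2 * d i)
      rw [mul_assoc] at this
      omega
    have h := abs_integral_pow_returnCount_sub_le hinv hd hinj hn1 hb hη0.le (min_le_left _ _) hm
      hper hr hθ hdecay hi hH (hω n) ht hN.le hz0 hz1
    rw [clumpWeight_div_eq] at h
    rw [Real.dist_eq, sub_zero]
    refine h.trans_lt ?_
    rw [mul_add]
    linarith
  obtain ⟨N, hN⟩ := eventually_atTop.1 hev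
  exact ⟨N, fun n hn => hN n hn.le⟩

theorem integral_pow_countLaw [DiscreteMeasurableSpace 𝒜] (d : Fin ℓ → ℕ) (t : ℝ) (ω : ℕ → 𝒜)
    (n : ℕ) (z : ℝ) :
    ∫ k, z ^ k ∂(countLaw P d t ω n : Measure ℕ) =
      ∫ x, z ^ returnCount d (cyl ω n) (trials P ℓ t ω n) x ∂P :=
  integral_map (measurable_returnCount d (measurableSet_cyl ω n) _).aemeasurable
    measurable_from_top.aestronglyMeasurable

theorem tendsto_integral_pow_of_tendsto {μs : ℕ → ProbabilityMeasure ℕ}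
    {μ : ProbabilityMeasure ℕ} (h : Tendsto μs atTop (𝓝 μ)) {z : ℝ} (hz0 : 0 ≤ z) (hz1 : z ≤ 1) :
    Tendsto (fun n => ∫ k, z ^ k ∂(μs n : Measure ℕ)) atTop (𝓝 (∫ k, z ^ k ∂(μ : Measure ℕ))) :=
  ProbabilityMeasure.tendsto_iff_forall_integral_tendsto.1 h
    (BoundedContinuousFunction.ofNormedAddCommGroupDiscrete (fun k : ℕ => z ^ k) 1 fun k => by
      rw [Real.norm_of_nonneg (pow_nonneg hz0 k)]
      exact pow_le_one₀ hz0 hz1)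

end

end ShiftReturns

/-! ### The two assertions. -/

theorem theorem3p2 {𝒜 : Type*} [Countable 𝒜] [Nontrivial 𝒜]
    [MeasurableSpace 𝒜] [DiscreteMeasurableSpace 𝒜]
    (P : Measure (ℕ → 𝒜)) [IsProbabilityMeasure P]
    (hinv : MeasurePreserving shift P P) (hmix : PsiMixing P)
    (hnondeg : ∀ a : 𝒜, P {x | x 0 = a} < 1)
    {ℓ : ℕ} (hℓ : 1 ≤ ℓ) (d : Fin ℓ → ℕ) (hd_pos : ∀ j, 1 ≤ d j) (hd : StrictMono d)
    (t : ℝ) (ht : 0 < t)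
    (ω : ℕ → 𝒜) (hω : ∀ n, 1 ≤ n → 0 < P (cyl ω n))
    (r : ℕ) (hr : 1 ≤ r) (hper : Function.minimalPeriod shift ω = r) :
    ((¬ ∃ ρ : ℝ, Tendsto (fun n => rho P d ω n) atTop (𝓝 ρ)) →
      ¬ ∃ μ : ProbabilityMeasure ℕ, Tendsto (fun n => countLaw P d t ω n) atTop (𝓝 μ)) ∧
    (∀ β : ℝ, Tendsto (fun n => beta P r ω n) atTop (𝓝 β) →
      ∃ ρ : ℝ, ρ = β ^ returnExponent d r ∧ 0 ≤ ρ ∧ ρ < 1 ∧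
        Tendsto (fun n => rho P d ω n) atTop (𝓝 ρ) ∧
        ∃ μ : ProbabilityMeasure ℕ, (μ : Measure ℕ) = polyaAeppli (t * (1 - ρ)) ρ ∧
          Tendsto (fun n => countLaw P d t ω n) atTop (𝓝 μ)) := by
  have hP : HasPeriods ω r := hper ▸ hasPeriods_minimalPeriod ω
  have hω' : ∀ n, 0 < P.real (cyl ω n) := fun n =>
    (ENNReal.toReal_pos (hω (n + 1) (by omega)).ne' (measure_ne_top _ _)).trans_le
      (measureReal_mono (cyl_anti ω (Nat.le_succ n)))
  obtain ⟨q, hq1, hq⟩ := exists_letter_bound hnondeg hP hr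
  obtain ⟨g, hg, θ, hθ, hθ1, hdecay⟩ := hmix.exists_decay ω hq1 hq
  have : Nonempty (Fin ℓ) := ⟨⟨0, hℓ⟩⟩
  obtain ⟨i, hi⟩ := Finite.exists_max d
  have hκ := kappa_pos d hr
  have hpgf := fun z hz0 hz1 => tendsto_integral_pow_returnCount_sub (z := z) hinv hmix hd_pos
    hd.injective hP hr hg hθ hθ1 hdecay hi hω' ht hz0 hz1
  simp only [← integral_pow_countLaw] at hpgf
  set R : ℕ → ℕ → ℝ := fun n a =>
    ∏ j, (P.real (cyl ω (n + d j * (a * kappa d r))) / P.real (cyl ω n)) with hRdef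
  have hR : ∀ n a, R n a ∈ Set.Icc (0 : ℝ) 1 := fun n a => prod_div_mem_Icc _
  have hR0 : ∀ n, R n 0 = 1 := fun n => by simp [hRdef, (hω' n).ne']
  have hR1 : ∀ᶠ n in atTop, R n 1 = rho P d ω n := by
    filter_upwards [eventually_ge_atTop (2 * r)] with n hn
    rw [rho_eq hP hr d hn]
    simp [hRdef]
  have hQ : Tendsto (fun n => n / (2 * d i) / kappa d r) atTop atTop :=
    (Nat.tendsto_div_const_atTop (by omega)).comp
      (Nat.tendsto_div_const_atTop (by have := hd_pos i; omega))
  refine ⟨fun hnolim => ?_, fun β hβ => ?_⟩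
  · rintro ⟨μ, hμ⟩
    apply hnolim
    -- At `z = 0` the generating function is the probability of no return, asymptotically `exp (-t *
    -- (1 - ρ_A))`.
    have h0 := hpgf 0 le_rfl zero_le_one
    have hlim : Tendsto (fun n => Real.exp (-(t * (1 - R n 1)))) atTop
        (𝓝 (∫ k, (0 : ℝ) ^ k ∂(μ : Measure ℕ))) := by
      have h1 := (tendsto_integral_pow_of_tendsto hμ le_rfl zero_le_one).sub h0
      rw [← sub_zero (∫ k, (0 : ℝ) ^ k ∂(μ : Measure ℕ))]
      refine h1.congr' ?_
      filter_upwards [hQ.eventually_ge_atTop 1] with n hn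
      rw [sub_sub_cancel, sub_zero, mul_one, sum_gapCoeff_zero_mul hn (R n), hR0]
    -- The approximants are at least `exp (-t)`, so the limit is positive, the logarithm is
    -- continuous there, and `ρ_A` can be solved for.
    have hpos : 0 < ∫ k, (0 : ℝ) ^ k ∂(μ : Measure ℕ) := by
      refine (Real.exp_pos (-t)).trans_le (ge_of_tendsto' hlim fun n => Real.exp_le_exp.2 ?_)
      nlinarith [(hR n 1).1]
    have hlog := (hlim.log hpos.ne').div_const t
    simp only [Real.log_exp] at hlog
    refine ⟨_, ((hlog.const_add 1).congr' ?_)⟩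
    filter_upwards [hR1] with n hn
    rw [← hn]
    field_simp
    ring
  · have hβmem : β ∈ Set.Icc (0 : ℝ) 1 := by
      refine isClosed_Icc.mem_of_tendsto hβ (Eventually.of_forall fun n => ?_)
      exact ⟨measureReal_nonneg, by
        rw [beta, cond_real_cyl]
        exact div_le_one_of_le₀ (measureReal_mono (cyl_anti ω (Nat.le_add_right _ _)))
          measureReal_nonneg⟩
    have hratio := tendsto_cyl_ratio (fun n => (hω' n).ne') hβ
    -- If `β = 1`, then extending the cylinder by `r * g ≥ g` letters would cost nothing in the
    -- limit, contrary to the decay factor `θ < 1` for `g` extra letters.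
    have hβ1 : β < 1 := by
      refine lt_of_le_of_ne hβmem.2 fun h1 => ?_
      have h2 := hratio g
      rw [h1, one_pow] at h2
      refine absurd (le_of_tendsto' h2 fun n => ?_) (not_le.2 hθ1)
      rw [div_le_iff₀ (hω' n)]
      have h3 := hdecay n n 1 _ (determinedBy_cyl ω n)
      rw [pow_one, mul_one] at h3
      have hsub : cyl ω (n + r * g) ⊆ cyl ω n ∩ shift^[n] ⁻¹' cyl (shift^[n] ω) g := by
        refine fun x hx => ⟨cyl_anti ω (Nat.le_add_right _ _) hx, fun s hs => ?_⟩
        rw [shift_iterate_apply, shift_iterate_apply]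
        exact hx _ (by nlinarith)
      exact (measureReal_mono hsub).trans h3
    have hRlim : ∀ a, Tendsto (fun n => R n a) atTop (𝓝 ((β ^ returnExponent d r) ^ a)) := by
      intro a
      have hval : (β ^ returnExponent d r) ^ a = ∏ j, β ^ (d j * kappa d r / r * a) := by
        rw [Finset.prod_pow_eq_pow_sum, ← Finset.sum_mul, ← returnExponent_eq_sum d hr, pow_mul]
      rw [hval]
      refine tendsto_finsetProd _ fun j _ => ?_
      refine (hratio (d j * kappa d r / r * a)).congr fun n => ?_
      rw [← mul_assoc r, Nat.mul_div_cancel' (dvd_mul_kappa d r j), mul_assoc (d j),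
        mul_comm a]
    set ρ := β ^ returnExponent d r
    have hρ0 : 0 ≤ ρ := pow_nonneg hβmem.1 _
    have hρ1 : ρ < 1 := pow_lt_one₀ hβmem.1 hβ1 (returnExponent_pos hd_pos i hr)
    have hs : 0 ≤ t * (1 - ρ) := mul_nonneg ht.le (by linarith)
    refine ⟨ρ, rfl, hρ0, hρ1, ?_, ⟨polyaAeppli (t * (1 - ρ)) ρ,
      isProbabilityMeasure_polyaAeppli hs hρ0 hρ1⟩, rfl, ?_⟩
    · have := hRlim 1
      rw [pow_one] at this
      exact this.congr' hR1
    · refine tendsto_of_tendsto_real_singleton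
        (tendsto_real_singleton_of_tendsto_integral_pow fun z hz0 hz1 => ?_)
      have hsum := tendsto_sum_gapCoeff_mul hz0.le hz1 hρ0 hρ1.le hQ hR hRlim
      have hexp := (Real.continuous_exp.tendsto _).comp ((hsum.const_mul (t * (1 - z))).neg)
      have h := ((hpgf z hz0.le hz1.le).add hexp).congr fun n => sub_add_cancel _ _
      rw [zero_add] at h
      have hval : ∫ k, z ^ k ∂(polyaAeppli (t * (1 - ρ)) ρ) =
          Real.exp (-(t * (1 - z) * ((1 - ρ) / (1 - ρ * z)))) := by
        rw [integral_pow_polyaAeppli hs hρ0 hρ1 hz0.le hz1.le]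
        congr 2
        ring
      rw [← hval] at h
      exact h
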